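/- Let $G$ be a connected finite simple graph with $n$ vertices and $m$ edges. For a set $A\subseteq E(G)$ let $k(A)$ be the number of connected components of the spanning subgraph $(V(G),A)$ and $r(A)=n-k(A)$ its rank; put $r(G)=r(E(G))$. Let $$T(G;x,y)=\sum_{A\subseteq E(G)}(x-1)^{r(G)-r(A)}(y-1)^{|A|-r(A)}$$ be the Tutte polynomial of $G$ and $T_x$ its partial derivative in $x$. The integrand in Steele's formula for the expected length of the minimal spanning tree of $G$ (with independent edge lengths uniform on $[0,1]$) is $$\frac{1-t}{t}\,\frac{T_x\left(G;\frac1t,\frac1{1-t}\right)}{T\left(G;\frac1t,\frac1{1-t}\right)},\qquad 0<t<1.$$ There is a unique real polynomial $p_m$ that agrees with this integrand for all $0<t<1$; it has degree at most $m$. Write $$p_m(t)=-1+\sum_{i=0}^m a_i t^i,$$ and $a_i=0$ for $i>m$. Then $$a_3=c_3,\qquad a_4=c_4,\qquad a_5=c_5-k_3^5,\qquad a_6=c_6+2k_4-c_{5,1}-k_{3,2},$$ where all counts are of not necessarily induced subgraphs of $G$: $c_i$ is the number of cycles of length $i$; $k_3^5$ is the number of sets $A\subseteq E(G)$ with $|A|=5$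 and $r(A)=3$; $c_{5,1}$ is the number of subgraphs that consist of a $5$-cycle together with exactly one chord of it; $k_4$ is the number of subgraphs isomorphic to $K_4$; and $k_{3,2}$ is the number of subgraphs isomorphic to $K_{3,2}$. -/

import Mathlib

open scoped Polynomial

namespace SteeleMST

variable {V : Type*} [Fintype V]

/-- The number `k(H)` of connected components of a graph. -/
noncomputable def numComponents (H : SimpleGraph V) : ℕ :=
  Nat.card H.ConnectedComponent

/-- The rank `r(H) = |V(H)| - k(H)`; the subtraction never truncates, as `k(H) ≤ |V(H)|`. -/
noncomputable def rank (H : SimpleGraph V) : ℕ :=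
  Fintype.card V - numComponents H

/-- The rank of the spanning subgraph with vertex set `V` and edge set `A`. -/
noncomputable def edgeRank (A : Finset (Sym2 V)) : ℕ :=
  rank (SimpleGraph.fromEdgeSet (A : Set (Sym2 V)))

/-- The Tutte polynomial `T(G; x, y)`, as a function of real `x` and `y`: the sum over all spanning
subgraphs `A`, given by their edge sets, of `(x-1)^(r(G)-r(A)) (y-1)^(|A|-r(A))`. The exponents do
not truncate, as `r(A) ≤ r(G)` and `r(A) ≤ |A|`. -/
noncomputable def tutte (G : SimpleGraph V) [Fintype G.edgeSet] (x y : ℝ) : ℝ :=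
  ∑ A ∈ G.edgeFinset.powerset,
    (x - 1) ^ (rank G - edgeRank A) * (y - 1) ^ (A.card - edgeRank A)

/-- The integrand of Steele's formula,
`((1-t)/t) * T_x(G; 1/t, 1/(1-t)) / T(G; 1/t, 1/(1-t))`, meaningful for `0 < t < 1`. -/
noncomputable def steeleIntegrand (G : SimpleGraph V) [Fintype G.edgeSet] (t : ℝ) : ℝ :=
  (1 - t) / t * (deriv (fun x => tutte G x (1 / (1 - t))) (1 / t) /
    tutte G (1 / t) (1 / (1 - t)))

/-- `p` is the polynomial integrand in Steele's formula for `G`. -/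
def IsSteelePolynomial (G : SimpleGraph V) [Fintype G.edgeSet] (p : ℝ[X]) : Prop :=
  ∀ t ∈ Set.Ioo (0 : ℝ) 1, p.eval t = steeleIntegrand G t

/-- `c_i`: the number of subgraphs of `G` that are cycles of length `i` (for `i ≥ 3`). -/
noncomputable def cycleCount (G : SimpleGraph V) (i : ℕ) : ℕ :=
  G.copyCount (SimpleGraph.cycleGraph i)

/-- `c_{i,1}`: the number of (not necessarily induced) subgraphs `H` of `G` that consist of a cycle
`C` of length `i` together with exactly one chord, an additional edge on the vertices of `C`. -/
noncomputable def chordedCycleCount (G : SimpleGraph V) (i : ℕ) : ℕ :=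
  Set.ncard {H : G.Subgraph | ∃ C : G.Subgraph, C ≤ H ∧
    Nonempty (SimpleGraph.cycleGraph i ≃g C.coe) ∧ C.verts = H.verts ∧
    (H.edgeSet \ C.edgeSet).ncard = 1}

/-- `k_i`: the number of subgraphs of `G` isomorphic to the complete graph `K_i`. -/
noncomputable def completeCount (G : SimpleGraph V) (i : ℕ) : ℕ :=
  G.copyCount (SimpleGraph.completeGraph (Fin i))

/-- `k_{i,j}`: the number of subgraphs of `G` isomorphic to `K_{i,j}`. -/
noncomputable def completeBipartiteCount (G : SimpleGraph V) (i j : ℕ) : ℕ :=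
  G.copyCount (completeBipartiteGraph (Fin i) (Fin j))

/-- `k_r^ℓ`: the number of spanning subgraphs of `G` with `ℓ` edges and rank `r`. -/
noncomputable def rankCount (G : SimpleGraph V) [Fintype G.edgeSet] (r ℓ : ℕ) : ℕ :=
  ((G.edgeFinset.powersetCard ℓ).filter (fun A => edgeRank A = r)).card

end SteeleMST

/-! At x = 1/t and y = 1/(1-t) one has (x-1)(y-1) = 1, so r(A) cancels from the summand of the Tutte
polynomial, which becomes c t^|A| (1-t)^(m-|A|) with c independent of A (`one_sub_pow_mul_weight`).
Hence T = c, while (x-1) T_x carries the extra factor r(G) - r(A): the integrand is the expectation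
of r(G) - r(A) for a random A containing each edge independently with probability t, a polynomial in
t.

Expanding the powers of 1-t, the coefficient of t^i is the sum, over the sets C of i edges, of the
Möbius transform of r(G) - r (`sum_mul_pow_eq_sum_mobius`). For nonempty C the constant r(G) drops
out and `beta C` remains. As r(B + uv) - r(B) is 0 or 1 according to whether B joins u and v, `beta`
of C + uv with C nonempty is the signed count of the B ⊆ C that join u to v (`beta_insert`). It
vanishes if uv is a pendant edge, so only edge sets without vertices of degree one contribute.

With three to six edges these are the cycles, the 4-cycle with a chord (diamond), K_4, the 5-cycle
with a chord (house), K_{3,2} (theta), and two triangles that share a vertex or are disjoint.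
Deletion-contraction gives `beta` = 1 on cycles, -1 on the diamond, house and theta, 2 on K_4, and 0
on pairs of triangles. The diamonds are exactly the 5-edge sets of rank 3. Summing over edge sets
gives the four coefficients. -/

namespace SteeleMST

/-- The vertices `x` and `y` are joined by a path with edges in `A`. -/
def Conn {V : Type*} (A : Finset (Sym2 V)) (x y : V) : Prop :=
  (SimpleGraph.fromEdgeSet (A : Set (Sym2 V))).Reachable x y

/-! ### Connectivity through an edge set -/

section Conn

variable {V : Type*} {A B : Finset (Sym2 V)} {u v x y z : V}

lemma Conn.refl (A : Finset (Sym2 V)) (x : V) : Conn A x x := SimpleGraph.Reachable.refl x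

lemma Conn.symm (h : Conn A x y) : Conn A y x := SimpleGraph.Reachable.symm h

lemma Conn.trans (h : Conn A x y) (h' : Conn A y z) : Conn A x z := SimpleGraph.Reachable.trans h h'

lemma Conn.mono (hAB : A ⊆ B) (h : Conn A x y) : Conn B x y :=
  SimpleGraph.Reachable.mono (SimpleGraph.fromEdgeSet_mono (by exact_mod_cast hAB)) h

lemma Conn.of_mem (h : s(x, y) ∈ A) : Conn A x y := by
  by_cases hxy : x = y
  · subst hxy; exact Conn.refl _ _
  · exact SimpleGraph.Adj.reachable ((SimpleGraph.fromEdgeSet_adj _).2 ⟨by exact_mod_cast h, hxy⟩)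

lemma Conn.eq_or_exists_mem (h : Conn A x y) : x = y ∨ ∃ w, x ≠ w ∧ s(x, w) ∈ A ∧ Conn A w y := by
  obtain ⟨p⟩ := h
  cases p with
  | nil => exact Or.inl rfl
  | cons h p =>
    rw [SimpleGraph.fromEdgeSet_adj] at h
    exact Or.inr ⟨_, h.2, by exact_mod_cast h.1, ⟨p⟩⟩

@[simp] lemma conn_empty : Conn (∅ : Finset (Sym2 V)) x y ↔ x = y := by
  constructor
  · intro h
    rcases h.eq_or_exists_mem with h | ⟨w, -, h, -⟩
    · exact h
    · simp at h
  · rintro rfl; exact Conn.refl _ _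

/-- Whatever a walk does between its first and last use of the new edge can be skipped, so one
crossing at most is needed. -/
lemma conn_insert [DecidableEq V] : Conn (insert s(u, v) A) x y ↔
    Conn A x y ∨ (Conn A x u ∧ Conn A v y) ∨ (Conn A x v ∧ Conn A u y) := by
  constructor
  · rintro ⟨p⟩
    induction p with
    | nil => exact Or.inl (Conn.refl _ _)
    | @cons a b c h p ih =>
      rw [SimpleGraph.fromEdgeSet_adj] at h
      have h1 : s(a, b) ∈ insert s(u, v) A := by exact_mod_cast h.1
      rcases Finset.mem_insert.1 h1 with h1 | h1
      · rw [Sym2.eq_iff] at h1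
        rcases h1 with ⟨rfl, rfl⟩ | ⟨rfl, rfl⟩
        · rcases ih with ih | ⟨_, ih⟩ | ⟨_, ih⟩
          · exact Or.inr (Or.inl ⟨Conn.refl _ _, ih⟩)
          · exact Or.inr (Or.inl ⟨Conn.refl _ _, ih⟩)
          · exact Or.inl ih
        · rcases ih with ih | ⟨_, ih⟩ | ⟨_, ih⟩
          · exact Or.inr (Or.inr ⟨Conn.refl _ _, ih⟩)
          · exact Or.inl ih
          · exact Or.inr (Or.inr ⟨Conn.refl _ _, ih⟩)
      · have h2 := Conn.of_mem h1
        rcases ih with ih | ⟨i1, i2⟩ | ⟨i1, i2⟩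
        · exact Or.inl (h2.trans ih)
        · exact Or.inr (Or.inl ⟨h2.trans i1, i2⟩)
        · exact Or.inr (Or.inr ⟨h2.trans i1, i2⟩)
  · have hs : A ⊆ insert s(u, v) A := Finset.subset_insert _ _
    have he : Conn (insert s(u, v) A) u v := Conn.of_mem (Finset.mem_insert_self _ _)
    rintro (h | ⟨h, h'⟩ | ⟨h, h'⟩)
    · exact h.mono hs
    · exact ((h.mono hs).trans he).trans (h'.mono hs)
    · exact ((h.mono hs).trans he.symm).trans (h'.mono hs)

end Conn

/-! ### Rank of an edge set -/

section Rank

variable {V : Type*} [Fintype V] {A B : Finset (Sym2 V)} {u v : V}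

lemma numComponents_le (H : SimpleGraph V) : numComponents H ≤ Fintype.card V := by
  rw [numComponents, ← Nat.card_eq_fintype_card]
  exact Nat.card_le_card_of_surjective H.connectedComponentMk Quot.mk_surjective

@[simp] lemma edgeRank_empty : edgeRank (∅ : Finset (Sym2 V)) = 0 := by
  have : numComponents (SimpleGraph.fromEdgeSet ((∅ : Finset (Sym2 V)) : Set (Sym2 V)))
      = Fintype.card V := by
    rw [numComponents, ← Nat.card_eq_fintype_card]
    symm
    refine Nat.card_eq_of_bijective
      (SimpleGraph.connectedComponentMk _) ⟨fun x y h => ?_, Quot.mk_surjective⟩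
    exact conn_empty.1 (SimpleGraph.ConnectedComponent.exact h)
  rw [edgeRank, rank, this, Nat.sub_self]

lemma edgeRank_insert_of_conn [DecidableEq V] (h : Conn A u v) :
    edgeRank (insert s(u, v) A) = edgeRank A := by
  have hle : SimpleGraph.fromEdgeSet (A : Set (Sym2 V)) ≤
      SimpleGraph.fromEdgeSet ((insert s(u, v) A : Finset (Sym2 V)) : Set (Sym2 V)) :=
    SimpleGraph.fromEdgeSet_mono (by exact_mod_cast Finset.subset_insert _ _)
  rw [edgeRank, edgeRank, rank, rank, numComponents, numComponents]
  congr 1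
  symm
  refine Nat.card_eq_of_bijective
    (SimpleGraph.ConnectedComponent.map (SimpleGraph.Hom.ofLE hle)) ⟨?_, ?_⟩
  · intro c d
    induction c using SimpleGraph.ConnectedComponent.ind with | _ x
    induction d using SimpleGraph.ConnectedComponent.ind with | _ y
    intro hxy
    have h1 : Conn (insert s(u, v) A) x y := SimpleGraph.ConnectedComponent.exact hxy
    apply SimpleGraph.ConnectedComponent.sound
    rcases conn_insert.1 h1 with h1 | ⟨h1, h2⟩ | ⟨h1, h2⟩
    · exact h1
    · exact (h1.trans h).trans h2
    · exact (h1.trans h.symm).trans h2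
  · intro c
    induction c using SimpleGraph.ConnectedComponent.ind with | _ x
    exact ⟨SimpleGraph.connectedComponentMk _ x, rfl⟩

lemma edgeRank_insert_of_not_conn [DecidableEq V] (h : ¬ Conn A u v) :
    edgeRank (insert s(u, v) A) = edgeRank A + 1 := by
  have hle : SimpleGraph.fromEdgeSet (A : Set (Sym2 V)) ≤
      SimpleGraph.fromEdgeSet ((insert s(u, v) A : Finset (Sym2 V)) : Set (Sym2 V)) :=
    SimpleGraph.fromEdgeSet_mono (by exact_mod_cast Finset.subset_insert _ _)
  set H := SimpleGraph.fromEdgeSet (A : Set (Sym2 V)) with hH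
  set H' := SimpleGraph.fromEdgeSet ((insert s(u, v) A : Finset (Sym2 V)) : Set (Sym2 V)) with hH'
  -- The new edge merges the component of v into that of u. Discarding the old component of v leaves
  -- one representative of each new component.
  have hbij : Function.Bijective (fun c : {c : H.ConnectedComponent // c ≠ H.connectedComponentMk v} =>
      SimpleGraph.ConnectedComponent.map (SimpleGraph.Hom.ofLE hle) c.1) := by
    constructor
    · rintro ⟨c, hc⟩ ⟨d, hd⟩
      induction c using SimpleGraph.ConnectedComponent.ind with | _ x
      induction d using SimpleGraph.ConnectedComponent.ind with | _ y
      intro hxy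
      have h1 : Conn (insert s(u, v) A) x y := SimpleGraph.ConnectedComponent.exact hxy
      apply Subtype.ext
      apply SimpleGraph.ConnectedComponent.sound
      rcases conn_insert.1 h1 with h1 | ⟨h1, h2⟩ | ⟨h1, h2⟩
      · exact h1
      · exact absurd (SimpleGraph.ConnectedComponent.sound h2.symm) hd
      · exact absurd (SimpleGraph.ConnectedComponent.sound h1) hc
    · intro c
      induction c using SimpleGraph.ConnectedComponent.ind with | _ x
      by_cases hx : Conn A x v
      · refine ⟨⟨H.connectedComponentMk u, fun h' => h (SimpleGraph.ConnectedComponent.exact h')⟩, ?_⟩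
        apply SimpleGraph.ConnectedComponent.sound
        exact conn_insert.2 (Or.inr (Or.inl ⟨Conn.refl _ _, hx.symm⟩))
      · exact ⟨⟨H.connectedComponentMk x, fun h' => hx (SimpleGraph.ConnectedComponent.exact h')⟩, rfl⟩
  have h1 : numComponents H = numComponents H' + 1 := by
    classical
    rw [numComponents, numComponents, ← Nat.card_eq_of_bijective _ hbij, Nat.card_eq_fintype_card,
      Nat.card_eq_fintype_card, Fintype.card_subtype_compl, Fintype.card_subtype_eq]
    have : 0 < Fintype.card H.ConnectedComponent :=
      Fintype.card_pos_iff.2 ⟨H.connectedComponentMk v⟩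
    omega
  have h2 := numComponents_le H
  rw [edgeRank, edgeRank, rank, rank, ← hH, ← hH']
  omega

open Classical in
lemma edgeRank_insert [DecidableEq V] (A : Finset (Sym2 V)) (u v : V) :
    (edgeRank (insert s(u, v) A) : ℤ) = edgeRank A + 1 - if Conn A u v then 1 else 0 := by
  split_ifs with h
  · rw [edgeRank_insert_of_conn h]; ring
  · rw [edgeRank_insert_of_not_conn h]; push_cast; ring

lemma edgeRank_le_insert [DecidableEq V] (A : Finset (Sym2 V)) (e : Sym2 V) :
    edgeRank A ≤ edgeRank (insert e A) ∧ edgeRank (insert e A) ≤ edgeRank A + 1 := by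
  induction e using Sym2.ind with | _ u v
  by_cases h : Conn A u v
  · rw [edgeRank_insert_of_conn h]; omega
  · rw [edgeRank_insert_of_not_conn h]; omega

lemma edgeRank_le_card (A : Finset (Sym2 V)) : edgeRank A ≤ A.card := by
  classical
  induction A using Finset.induction_on with
  | empty => simp
  | insert e A he ih =>
    rw [Finset.card_insert_of_notMem he]
    exact (edgeRank_le_insert A e).2.trans (by omega)

lemma edgeRank_mono (h : A ⊆ B) : edgeRank A ≤ edgeRank B := by
  classical
  obtain ⟨C, rfl⟩ : ∃ C, B = C ∪ A := ⟨B, (Finset.union_eq_left.2 h).symm⟩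
  clear h
  induction C using Finset.induction_on with
  | empty => simp
  | insert e C he ih =>
    rw [Finset.insert_union]
    exact ih.trans (edgeRank_le_insert _ e).1

lemma edgeRank_edgeFinset (G : SimpleGraph V) [Fintype G.edgeSet] :
    edgeRank G.edgeFinset = rank G := by
  rw [edgeRank, SimpleGraph.coe_edgeFinset, SimpleGraph.fromEdgeSet_edgeSet]

end Rank

/-! ### Möbius transform over subsets -/

section Mobius

variable {α : Type*} [DecidableEq α]

/-- The Möbius transform of a set function. -/
def mobius (g : Finset α → ℤ) (A : Finset α) : ℤ :=
  ∑ B ∈ A.powerset, (-1) ^ (A \ B).card * g B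

@[simp] lemma mobius_empty (g : Finset α → ℤ) : mobius g ∅ = g ∅ := by simp [mobius]

lemma card_insert_sdiff_of_subset {e : α} {A B : Finset α} (he : e ∉ A) (hB : B ⊆ A) :
    (insert e A \ B).card = (A \ B).card + 1 := by
  rw [Finset.insert_sdiff_of_notMem _ (fun h => he (hB h)),
    Finset.card_insert_of_notMem (by simp [he])]

lemma insert_sdiff_insert_of_notMem {e : α} {A B : Finset α} (he : e ∉ A) :
    insert e A \ insert e B = A \ B := by
  rw [Finset.insert_sdiff_insert, Finset.sdiff_insert_of_notMem he]

/-- Pair each subset B of A with B + e; the two carry opposite signs. -/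
lemma mobius_insert (g : Finset α → ℤ) {e : α} {A : Finset α} (he : e ∉ A) :
    mobius g (insert e A) = mobius (fun B => g (insert e B)) A - mobius g A := by
  rw [mobius, Finset.sum_powerset_insert he, mobius, mobius, add_comm, sub_eq_add_neg,
    ← Finset.sum_neg_distrib]
  congr 1
  · refine Finset.sum_congr rfl fun B hB => ?_
    rw [insert_sdiff_insert_of_notMem he]
  · refine Finset.sum_congr rfl fun B hB => ?_
    rw [card_insert_sdiff_of_subset he (Finset.mem_powerset.1 hB)]
    ring

lemma mobius_sub (g h : Finset α → ℤ) (A : Finset α) :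
    mobius (fun B => g B - h B) A = mobius g A - mobius h A := by
  simp [mobius, mul_sub]

lemma mobius_const (c : ℤ) {A : Finset α} (hA : A.Nonempty) : mobius (fun _ => c) A = 0 := by
  obtain ⟨e, he⟩ := hA
  rw [← Finset.insert_erase he, mobius_insert _ (Finset.notMem_erase e A), sub_self]

lemma mobius_congr {g h : Finset α → ℤ} {A : Finset α} (H : ∀ B ⊆ A, g B = h B) :
    mobius g A = mobius h A :=
  Finset.sum_congr rfl fun B hB => by rw [H B (Finset.mem_powerset.1 hB)]

/-- Condition on whether e is chosen: (1-t) E[g(A)] + t E[g(A+e)] = E[g(A)] + t E[g(A+e) - g(A)],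
and the difference in the last term is what `mobius_insert` transforms. -/
lemma sum_mul_pow_eq_sum_mobius {R : Type*} [CommRing R] (t : R) (g : Finset α → ℤ)
    (E : Finset α) :
    ∑ A ∈ E.powerset, (g A : R) * (t ^ A.card * (1 - t) ^ (E \ A).card) =
      ∑ C ∈ E.powerset, (mobius g C : R) * t ^ C.card := by
  induction E using Finset.induction_on generalizing g with
  | empty => simp
  | insert e E he ih =>
    rw [Finset.sum_powerset_insert he, Finset.sum_powerset_insert he]
    have h1 : ∑ A ∈ E.powerset, (g A : R) * (t ^ A.card * (1 - t) ^ (insert e E \ A).card) =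
        (1 - t) * ∑ A ∈ E.powerset, (g A : R) * (t ^ A.card * (1 - t) ^ (E \ A).card) := by
      rw [Finset.mul_sum]
      refine Finset.sum_congr rfl fun B hB => ?_
      rw [card_insert_sdiff_of_subset he (Finset.mem_powerset.1 hB)]
      ring
    have h2 : ∑ A ∈ E.powerset, (g (insert e A) : R) *
        (t ^ (insert e A).card * (1 - t) ^ (insert e E \ insert e A).card) =
        t * ∑ A ∈ E.powerset, (g (insert e A) : R) * (t ^ A.card * (1 - t) ^ (E \ A).card) := by
      rw [Finset.mul_sum]
      refine Finset.sum_congr rfl fun B hB => ?_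
      rw [insert_sdiff_insert_of_notMem he,
        Finset.card_insert_of_notMem fun h => he (Finset.mem_powerset.1 hB h)]
      ring
    have h3 : ∑ C ∈ E.powerset, (mobius g (insert e C) : R) * t ^ (insert e C).card =
        t * ∑ C ∈ E.powerset, (mobius (fun B => g (insert e B)) C : R) * t ^ C.card -
        t * ∑ C ∈ E.powerset, (mobius g C : R) * t ^ C.card := by
      rw [Finset.mul_sum, Finset.mul_sum, ← Finset.sum_sub_distrib]
      refine Finset.sum_congr rfl fun B hB => ?_
      have hB' : e ∉ B := fun h => he (Finset.mem_powerset.1 hB h)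
      rw [mobius_insert _ hB', Finset.card_insert_of_notMem hB']
      push_cast
      ring
    rw [h1, h2, h3, ih, ih (fun A => g (insert e A))]
    ring

end Mobius

/-! ### The beta invariant -/

section Beta

variable {V : Type*} [Fintype V] [DecidableEq V] {A : Finset (Sym2 V)} {u v : V}

/-- Up to sign, Crapo's beta invariant of the cycle matroid of the edge set `A`. -/
noncomputable def beta (A : Finset (Sym2 V)) : ℤ := -mobius (fun B => (edgeRank B : ℤ)) A

lemma mobius_sub_edgeRank (c : ℤ) (hA : A.Nonempty) :
    mobius (fun B => c - (edgeRank B : ℤ)) A = beta A := by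
  rw [mobius_sub, mobius_const c hA, beta, zero_sub]

open Classical in
-- The rank increment of uv over B is 1 minus the indicator that B joins u and v, and the constant 1
-- is killed because A is nonempty.
lemma beta_insert (hA : A.Nonempty) (h : s(u, v) ∉ A) :
    beta (insert s(u, v) A) = mobius (fun B => if Conn B u v then 1 else 0) A := by
  rw [beta, mobius_insert _ h, ← mobius_sub]
  have : ∀ B : Finset (Sym2 V), (edgeRank (insert s(u, v) B) : ℤ) - edgeRank B =
      1 - if Conn B u v then 1 else 0 := fun B => by rw [edgeRank_insert]; ring
  simp only [this]
  rw [mobius_sub, mobius_const 1 hA]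
  ring

/-- `v` is a vertex of degree one of the edge set `A`, with neighbour `u`. -/
def IsPendant (A : Finset (Sym2 V)) (u v : V) : Prop :=
  u ≠ v ∧ s(u, v) ∈ A ∧ ∀ w, s(w, v) ∈ A → w = u

omit [Fintype V] in
lemma IsPendant.not_conn {B : Finset (Sym2 V)} (h : IsPendant A u v) (hB : B ⊆ A.erase s(u, v)) :
    ¬ Conn B u v := by
  intro hc
  rcases hc.symm.eq_or_exists_mem with h1 | ⟨w, -, hw, -⟩
  · exact h.1 h1.symm
  · have h2 := Finset.mem_erase.1 (hB hw)
    rw [Sym2.eq_swap] at h2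
    exact h2.1 (by rw [h.2.2 w h2.2])

/-- No set of the other edges reaches v, so every term of the signed count is 0. A single edge must
be excluded: there `beta` is -1. -/
lemma IsPendant.beta_eq_zero (h : IsPendant A u v) (hA : 1 < A.card) : beta A = 0 := by
  classical
  have hne : (A.erase s(u, v)).Nonempty := by
    rw [← Finset.card_pos, Finset.card_erase_of_mem h.2.1]; omega
  rw [← Finset.insert_erase h.2.1, beta_insert hne (Finset.notMem_erase _ _)]
  rw [mobius_congr (h := fun _ => 0) fun B hB => if_neg (h.not_conn hB), mobius_const 0 hne]

lemma IsPendant.edgeRank_eq (h : IsPendant A u v) :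
    edgeRank A = edgeRank (A.erase s(u, v)) + 1 := by
  conv_lhs => rw [← Finset.insert_erase h.2.1]
  exact edgeRank_insert_of_not_conn (h.not_conn subset_rfl)

end Beta

/-! ### Copies of a fixed graph, and computable rank and beta -/

section Shape

variable {V W : Type*} [DecidableEq V]

/-- The image under `f` of the edge set listed in `L`. -/
def edgesOf (f : W → V) (L : List (W × W)) : Finset (Sym2 V) :=
  (L.map fun p => s(f p.1, f p.2)).toFinset

/-- `A` is the edge set of a copy of the graph with edges listed in `L`. -/
def HasShape (L : List (W × W)) (A : Finset (Sym2 V)) : Prop :=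
  ∃ f : W → V, Function.Injective f ∧ A = edgesOf f L

@[simp] lemma edgesOf_nil (f : W → V) : edgesOf f [] = ∅ := rfl

@[simp] lemma edgesOf_cons (f : W → V) (p : W × W) (L : List (W × W)) :
    edgesOf f (p :: L) = insert s(f p.1, f p.2) (edgesOf f L) := by
  simp [edgesOf]

lemma mem_edgesOf {f : W → V} (hf : Function.Injective f) {L : List (W × W)} {x y : W} :
    s(f x, f y) ∈ edgesOf f L ↔ s(x, y) ∈ L.map fun p => s(p.1, p.2) := by
  simp only [edgesOf, List.mem_toFinset, List.mem_map]
  refine exists_congr fun p => and_congr_right fun _ => ?_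
  simp only [Sym2.eq_iff, hf.eq_iff]

omit [DecidableEq V] in
lemma nodup_map_edges {f : W → V} (hf : Function.Injective f) {L : List (W × W)}
    (hL : (L.map fun p => s(p.1, p.2)).Nodup) : (L.map fun p => s(f p.1, f p.2)).Nodup := by
  have := hL.map (Sym2.map.injective hf)
  rwa [List.map_map] at this

lemma HasShape.card_eq {L : List (W × W)} {A : Finset (Sym2 V)} (h : HasShape L A)
    (hL : (L.map fun p => s(p.1, p.2)).Nodup) : A.card = L.length := by
  obtain ⟨f, hf, rfl⟩ := h
  rw [edgesOf, List.toFinset_card_of_nodup (nodup_map_edges hf hL), List.length_map]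

variable [DecidableEq W]

/-- Merge the label classes of `x` and `y` in the labelling `c`. -/
def merge (c : W → W) (x y : W) : W → W := fun w => if c w = c y then c x else c w

/-- Deletion-contraction for the signed sum of the indicators of `u` and `v` being joined, over the
subsets of the listed edges, where vertices with equal labels are identified. -/
def delContr (u v : W) : List (W × W) → (W → W) → ℤ
  | [], c => if c u = c v then 1 else 0
  | p :: L, c => delContr u v L (merge c p.1 p.2) - delContr u v L c

/-- The rank of the listed edges, where vertices with equal labels are identified. -/
def listRank : List (W × W) → (W → W) → ℕ
  | [], _ => 0
  | p :: L, c => listRank L (merge c p.1 p.2) + if c p.1 = c p.2 then 0 else 1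

/-- The value of `beta` for the edges listed in `L`. -/
def listBeta : List (W × W) → ℤ
  | [] => 0
  | p :: L => delContr p.1 p.2 L id

/-- The labelling `c` describes the components of `A` on the vertices in the range of `f`. -/
def Labels (f : W → V) (A : Finset (Sym2 V)) (c : W → W) : Prop :=
  ∀ x y, Conn A (f x) (f y) ↔ c x = c y

omit [DecidableEq V] [DecidableEq W] in
lemma labels_empty {f : W → V} (hf : Function.Injective f) : Labels f ∅ id := fun x y => by
  simp [hf.eq_iff]

lemma Labels.insert {f : W → V} {A : Finset (Sym2 V)} {c : W → W} (h : Labels f A c) (u v : W) :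
    Labels f (insert s(f u, f v) A) (merge c u v) := by
  intro x y
  rw [conn_insert, h x y, h x u, h v y, h x v, h u y]
  simp only [merge]
  grind

open Classical in
-- Here A collects the edges contracted so far, with components recorded by c. Each further edge of
-- L is either contracted (added to A) or deleted, with a minus sign.
lemma mobius_edgesOf {f : W → V} (u v : W) {L : List (W × W)} {A : Finset (Sym2 V)} {c : W → W}
    (h : Labels f A c) (hL : (L.map fun p => s(f p.1, f p.2)).Nodup) :
    mobius (fun B => if Conn (B ∪ A) (f u) (f v) then 1 else 0) (edgesOf f L) =
      delContr u v L c := by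
  induction L generalizing A c with
  | nil => simp [delContr, h u v]
  | cons p L ih =>
    rw [List.map_cons, List.nodup_cons] at hL
    rw [edgesOf_cons, mobius_insert _ (by simpa [edgesOf] using hL.1), delContr,
      ← ih (h.insert p.1 p.2) hL.2, ← ih h hL.2]
    simp only [Finset.insert_union, Finset.union_insert]

variable [Fintype V]

/-- Moves `beta` from V to the finite index type, where `decide` can evaluate it. The length bound
leaves an edge besides the first, as `beta_insert` requires. -/
lemma HasShape.beta_eq {L : List (W × W)} {A : Finset (Sym2 V)} (h : HasShape L A)
    (hL : (L.map fun p => s(p.1, p.2)).Nodup) (hlen : 1 < L.length) : beta A = listBeta L := by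
  obtain ⟨f, hf, rfl⟩ := h
  match L, hlen with
  | p :: q :: L, _ =>
    have h' := nodup_map_edges hf hL
    rw [List.map_cons, List.nodup_cons] at h'
    rw [edgesOf_cons, beta_insert (by simp) (by simpa [edgesOf] using h'.1), listBeta,
      ← mobius_edgesOf p.1 p.2 (labels_empty hf) h'.2]
    exact mobius_congr fun B _ => by rw [Finset.union_empty]

lemma edgeRank_edgesOf {f : W → V} {L : List (W × W)} {A : Finset (Sym2 V)} {c : W → W}
    (h : Labels f A c) : edgeRank (edgesOf f L ∪ A) = edgeRank A + listRank L c := by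
  induction L generalizing A c with
  | nil => simp [listRank]
  | cons p L ih =>
    rw [edgesOf_cons, Finset.insert_union, ← Finset.union_insert, ih (h.insert p.1 p.2), listRank]
    split_ifs with hc
    · rw [edgeRank_insert_of_conn ((h _ _).2 hc)]; ring
    · rw [edgeRank_insert_of_not_conn (mt (h _ _).1 hc)]; ring

lemma HasShape.edgeRank_eq {L : List (W × W)} {A : Finset (Sym2 V)} (h : HasShape L A) :
    edgeRank A = listRank L id := by
  obtain ⟨f, hf, rfl⟩ := h
  have := edgeRank_edgesOf (L := L) (labels_empty hf)
  simpa using this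

end Shape

/-! ### The shapes with at most six edges -/

section Lists

/-- The edges of the triangle. -/
def triangleEdges : List (Fin 3 × Fin 3) := [(0, 1), (1, 2), (2, 0)]
/-- The edges of the 4-cycle. -/
def squareEdges : List (Fin 4 × Fin 4) := [(0, 1), (1, 2), (2, 3), (3, 0)]
/-- The edges of the 5-cycle. -/
def pentagonEdges : List (Fin 5 × Fin 5) := [(0, 1), (1, 2), (2, 3), (3, 4), (4, 0)]
/-- The edges of the 6-cycle. -/
def hexagonEdges : List (Fin 6 × Fin 6) := [(0, 1), (1, 2), (2, 3), (3, 4), (4, 5), (5, 0)]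
/-- The edges of the 4-cycle with a chord. -/
def diamondEdges : List (Fin 4 × Fin 4) := [(0, 1), (1, 2), (2, 3), (3, 0), (0, 2)]
/-- The edges of `K_4`. -/
def tetraEdges : List (Fin 4 × Fin 4) := [(0, 1), (1, 2), (2, 3), (3, 0), (0, 2), (1, 3)]
/-- The edges of the 5-cycle with a chord. -/
def houseEdges : List (Fin 5 × Fin 5) := [(0, 1), (1, 2), (2, 3), (3, 4), (4, 0), (0, 2)]
/-- The edges of `K_{3,2}`, with parts `{0, 1, 2}` and `{3, 4}`. -/
def thetaEdges : List (Fin 5 × Fin 5) := [(0, 3), (0, 4), (1, 3), (1, 4), (2, 3), (2, 4)]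
/-- The edges of two triangles sharing a vertex. -/
def bowtieEdges : List (Fin 5 × Fin 5) := [(0, 1), (1, 2), (2, 0), (2, 3), (3, 4), (4, 2)]
/-- The edges of two disjoint triangles. -/
def twoTriangleEdges : List (Fin 6 × Fin 6) := [(0, 1), (1, 2), (2, 0), (3, 4), (4, 5), (5, 3)]

variable {V : Type*} [Fintype V] [DecidableEq V] {A : Finset (Sym2 V)}

lemma beta_of_triangle (h : HasShape triangleEdges A) : beta A = 1 :=
  (h.beta_eq (by decide) (by decide)).trans (by decide)
lemma beta_of_square (h : HasShape squareEdges A) : beta A = 1 :=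
  (h.beta_eq (by decide) (by decide)).trans (by decide)
lemma beta_of_pentagon (h : HasShape pentagonEdges A) : beta A = 1 :=
  (h.beta_eq (by decide) (by decide)).trans (by decide)
lemma beta_of_hexagon (h : HasShape hexagonEdges A) : beta A = 1 :=
  (h.beta_eq (by decide) (by decide)).trans (by decide)
lemma beta_of_diamond (h : HasShape diamondEdges A) : beta A = -1 :=
  (h.beta_eq (by decide) (by decide)).trans (by decide)
lemma beta_of_tetra (h : HasShape tetraEdges A) : beta A = 2 :=
  (h.beta_eq (by decide) (by decide)).trans (by decide)
lemma beta_of_house (h : HasShape houseEdges A) : beta A = -1 :=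
  (h.beta_eq (by decide) (by decide)).trans (by decide)
lemma beta_of_theta (h : HasShape thetaEdges A) : beta A = -1 :=
  (h.beta_eq (by decide) (by decide)).trans (by decide)
-- No cycle meets both triangles in an edge, so the cycle matroid is disconnected; this is why the
-- value is 0, here and for disjoint triangles.
lemma beta_of_bowtie (h : HasShape bowtieEdges A) : beta A = 0 :=
  (h.beta_eq (by decide) (by decide)).trans (by decide)
lemma beta_of_twoTriangle (h : HasShape twoTriangleEdges A) : beta A = 0 :=
  (h.beta_eq (by decide) (by decide)).trans (by decide)

lemma edgeRank_of_square (h : HasShape squareEdges A) : edgeRank A = 3 :=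
  h.edgeRank_eq.trans (by decide)
lemma edgeRank_of_pentagon (h : HasShape pentagonEdges A) : edgeRank A = 4 :=
  h.edgeRank_eq.trans (by decide)
lemma edgeRank_of_diamond (h : HasShape diamondEdges A) : edgeRank A = 3 :=
  h.edgeRank_eq.trans (by decide)
lemma edgeRank_of_triangle (h : HasShape triangleEdges A) : edgeRank A = 2 :=
  h.edgeRank_eq.trans (by decide)

omit [Fintype V] in
/-- `K_{3,2}` is bipartite, and the 5-cycle with a chord contains a triangle. -/
lemma not_theta_of_house (h : HasShape houseEdges A) : ¬ HasShape thetaEdges A := by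
  obtain ⟨f, hf, rfl⟩ := h
  rintro ⟨g, hg, h⟩
  -- Membership in {g 3, g 4} properly 2-colours the theta; the triangle f 0, f 1, f 2 then gives a
  -- contradiction.
  have key : ∀ x y : V, s(x, y) ∈ edgesOf g thetaEdges →
      (x ∈ ({g 3, g 4} : Set V) ↔ y ∉ ({g 3, g 4} : Set V)) := by
    intro x y hxy
    simp only [edgesOf, thetaEdges, List.mem_toFinset, List.mem_map] at hxy
    obtain ⟨p, hp, hxy⟩ := hxy
    rw [Sym2.eq_iff] at hxy
    fin_cases hp <;> rcases hxy with ⟨rfl, rfl⟩ | ⟨rfl, rfl⟩ <;> simp [hg.eq_iff]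
  rw [← h] at key
  have h1 := key (f 0) (f 1) (by simp [houseEdges])
  have h2 := key (f 1) (f 2) (by simp [houseEdges])
  have h3 := key (f 0) (f 2) (by simp [houseEdges])
  tauto

end Lists

/-! ### Leafless edge sets with three to six edges -/

section Classification

set_option linter.unusedSimpArgs false
set_option linter.unnecessarySeqFocus false

variable {V : Type*} [DecidableEq V] {A : Finset (Sym2 V)}

/-- `A` has no loops and no vertices of degree one. -/
structure Leafless (A : Finset (Sym2 V)) : Prop where
  loopless : ∀ x, s(x, x) ∉ A
  not_isPendant : ∀ u v, ¬ IsPendant A u v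

omit [DecidableEq V] in
lemma mem_swap {x y : V} (h : s(x, y) ∈ A) : s(y, x) ∈ A := by rwa [Sym2.eq_swap]

omit [DecidableEq V] in
-- A walk can always be continued without backtracking; this drives the whole classification.
lemma Leafless.exists_next (hA : Leafless A) {x y : V} (h : s(x, y) ∈ A) :
    ∃ z, z ≠ x ∧ z ≠ y ∧ s(y, z) ∈ A := by
  by_contra! hc
  have hxy : x ≠ y := by rintro rfl; exact hA.loopless _ h
  refine hA.not_isPendant x y ⟨hxy, h, fun w hw => ?_⟩
  by_contra hwx
  exact hc w hwx (by rintro rfl; exact hA.loopless _ hw) (mem_swap hw)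

lemma mem_of_card_eq {L : List (Sym2 V)} (hL : L.Nodup) (hLA : ∀ e ∈ L, e ∈ A)
    (hc : A.card = L.length) {e : Sym2 V} (he : e ∈ A) : e ∈ L := by
  have h1 : L.toFinset = A := by
    apply Finset.eq_of_subset_of_card_le
    · intro e he; exact hLA e (List.mem_toFinset.1 he)
    · rw [List.toFinset_card_of_nodup hL, hc]
  rwa [← h1, List.mem_toFinset] at he

lemma exists_not_mem_of_length_lt {L : List (Sym2 V)} (hc : L.length < A.card) :
    ∃ p q, s(p, q) ∈ A ∧ s(p, q) ∉ L := by
  by_contra! h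
  have : A ⊆ L.toFinset := fun e he => by
    induction e using Sym2.ind with | _ p q
    exact List.mem_toFinset.2 (h p q he)
  have := Finset.card_le_card this
  have := L.toFinset_card_le
  omega

/-- The edge missing from a list of all but one edges of a leafless set joins two vertices of
listed edges. -/
lemma Leafless.exists_last (hA : Leafless A) {L : List (Sym2 V)} (hL : L.Nodup)
    (hLA : ∀ e ∈ L, e ∈ A) (hc : A.card = L.length + 1) :
    ∃ p q, s(p, q) ∈ A ∧ s(p, q) ∉ L ∧ p ≠ q ∧ (∃ e ∈ L, p ∈ e) ∧ (∃ e ∈ L, q ∈ e) := by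
  obtain ⟨p, q, h, h'⟩ := exists_not_mem_of_length_lt (A := A) (L := L) (by omega)
  -- The second edge at p must be listed, since pq is the only unlisted edge.
  have key : ∀ p q, s(p, q) ∈ A → s(p, q) ∉ L → ∃ e ∈ L, p ∈ e := by
    intro p q h h'
    obtain ⟨z, hz, -, hz'⟩ := hA.exists_next (mem_swap h)
    have := mem_of_card_eq (A := A) (L := s(p, q) :: L) (List.nodup_cons.2 ⟨h', hL⟩)
      (by simpa [h] using hLA) (by simpa using hc) hz'
    rcases List.mem_cons.1 this with h1 | h1
    · rw [Sym2.congr_right] at h1; exact absurd h1 hz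
    · exact ⟨_, h1, Sym2.mem_mk_left _ _⟩
  refine ⟨p, q, h, h', ?_, key p q h h', key q p (mem_swap h) (by rwa [Sym2.eq_swap])⟩
  rintro rfl; exact hA.loopless _ h

/-- When all but two edges of a leafless set are listed, either one missing edge joins two vertices
of listed edges, or the two missing edges join a new vertex to such vertices. -/
lemma Leafless.exists_last_two (hA : Leafless A) {L : List (Sym2 V)} (hL : L.Nodup)
    (hLA : ∀ e ∈ L, e ∈ A) (hc : A.card = L.length + 2) :
    (∃ p q, s(p, q) ∈ A ∧ s(p, q) ∉ L ∧ p ≠ q ∧ (∃ e ∈ L, p ∈ e) ∧ (∃ e ∈ L, q ∈ e)) ∨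
    ∃ p q r, s(p, q) ∈ A ∧ s(p, r) ∈ A ∧ q ≠ r ∧ (∀ e ∈ L, p ∉ e) ∧ (∃ e ∈ L, q ∈ e) ∧
      (∃ e ∈ L, r ∈ e) := by
  obtain ⟨p, q, h, h'⟩ := exists_not_mem_of_length_lt (A := A) (L := L) (by omega)
  -- If p is on no listed edge, both missing edges pq and pr meet at p. The second edges at q and at
  -- r are then listed.
  have key : ∀ p q, s(p, q) ∈ A → s(p, q) ∉ L → (∀ e ∈ L, p ∉ e) →
      ∃ p q r, s(p, q) ∈ A ∧ s(p, r) ∈ A ∧ q ≠ r ∧ (∀ e ∈ L, p ∉ e) ∧ (∃ e ∈ L, q ∈ e) ∧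
      (∃ e ∈ L, r ∈ e) := by
    intro p q h h' hp
    obtain ⟨r, hr, hrp, hr'⟩ := hA.exists_next (mem_swap h)
    have hpq : p ≠ q := by rintro rfl; exact hA.loopless _ h
    have hne : s(p, r) ∉ L := fun hm => hp _ hm (Sym2.mem_mk_left _ _)
    have hall : ∀ e ∈ A, e = s(p, q) ∨ e = s(p, r) ∨ e ∈ L := fun e he => by
      have := mem_of_card_eq (A := A) (L := s(p, q) :: s(p, r) :: L) (e := e) (by
        simp only [List.nodup_cons, List.mem_cons, not_or]
        exact ⟨⟨by rw [Sym2.congr_right]; exact hr.symm, h'⟩, hne, hL⟩)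
        (by simpa [h, hr'] using hLA) (by simpa using hc) he
      simpa using this
    refine ⟨p, q, r, h, hr', hr.symm, hp, ?_, ?_⟩
    · obtain ⟨w, hw, -, hw'⟩ := hA.exists_next h
      rcases hall _ hw' with h1 | h1 | h1
      · rw [Sym2.eq_iff] at h1; grind
      · rw [Sym2.eq_iff] at h1; grind
      · exact ⟨_, h1, Sym2.mem_mk_left _ _⟩
    · obtain ⟨w, hw, -, hw'⟩ := hA.exists_next hr'
      rcases hall _ hw' with h1 | h1 | h1
      · rw [Sym2.eq_iff] at h1; grind
      · rw [Sym2.eq_iff] at h1; grind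
      · exact ⟨_, h1, Sym2.mem_mk_left _ _⟩
  by_cases hp : ∃ e ∈ L, p ∈ e
  · by_cases hq : ∃ e ∈ L, q ∈ e
    · exact Or.inl ⟨p, q, h, h', by rintro rfl; exact hA.loopless _ h, hp, hq⟩
    · exact Or.inr (key q p (mem_swap h) (by rwa [Sym2.eq_swap]) (by simpa using hq))
  · exact Or.inr (key p q h h' (by simpa using hp))

lemma HasShape.of_forall_mem {n : ℕ} {L : List (Fin n × Fin n)} (f : Fin n → V)
    (hf : (List.ofFn f).Nodup) (hL : (L.map fun p => s(p.1, p.2)).Nodup)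
    (h : ∀ p ∈ L, s(f p.1, f p.2) ∈ A) (hc : A.card = L.length) : HasShape L A := by
  have hf' := List.nodup_ofFn.1 hf
  refine ⟨f, hf', (Finset.eq_of_subset_of_card_le ?_ ?_).symm⟩
  · intro e he
    simp only [edgesOf, List.mem_toFinset, List.mem_map] at he
    obtain ⟨p, hp, rfl⟩ := he
    exact h p hp
  · rw [edgesOf, List.toFinset_card_of_nodup (nodup_map_edges hf' hL), List.length_map, hc]

/-- In this and the following lemmas the default arguments find distinctness and edges among the
hypotheses, up to orientation, so that a use only has to name the vertices. -/
lemma hasShape_triangle (a b c : V) (hc : A.card = 3)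
    (hn : [a, b, c].Nodup := by first | assumption | (simp at * <;> grind only))
    (h1 : s(a, b) ∈ A := by first | assumption | exact mem_swap (by assumption))
    (h2 : s(b, c) ∈ A := by first | assumption | exact mem_swap (by assumption))
    (h3 : s(c, a) ∈ A := by first | assumption | exact mem_swap (by assumption)) :
    HasShape triangleEdges A :=
  .of_forall_mem ![a, b, c] (by simpa using hn) (by decide)
    (by simp [triangleEdges, h1, h2, h3]) hc

lemma hasShape_square (a b c d : V) (hc : A.card = 4)
    (hn : [a, b, c, d].Nodup := by first | assumption | (simp at * <;> grind only))
    (h1 : s(a, b) ∈ A := by first | assumption | exact mem_swap (by assumption))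
    (h2 : s(b, c) ∈ A := by first | assumption | exact mem_swap (by assumption))
    (h3 : s(c, d) ∈ A := by first | assumption | exact mem_swap (by assumption))
    (h4 : s(d, a) ∈ A := by first | assumption | exact mem_swap (by assumption)) :
    HasShape squareEdges A :=
  .of_forall_mem ![a, b, c, d] (by simpa using hn) (by decide)
    (by simp [squareEdges, h1, h2, h3, h4]) hc

lemma hasShape_pentagon (a b c d e : V) (hc : A.card = 5)
    (hn : [a, b, c, d, e].Nodup := by first | assumption | (simp at * <;> grind only))
    (h1 : s(a, b) ∈ A := by first | assumption | exact mem_swap (by assumption))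
    (h2 : s(b, c) ∈ A := by first | assumption | exact mem_swap (by assumption))
    (h3 : s(c, d) ∈ A := by first | assumption | exact mem_swap (by assumption))
    (h4 : s(d, e) ∈ A := by first | assumption | exact mem_swap (by assumption))
    (h5 : s(e, a) ∈ A := by first | assumption | exact mem_swap (by assumption)) :
    HasShape pentagonEdges A :=
  .of_forall_mem ![a, b, c, d, e] (by simpa using hn) (by decide)
    (by simp [pentagonEdges, h1, h2, h3, h4, h5]) hc

lemma hasShape_hexagon (a b c d e f : V) (hc : A.card = 6)
    (hn : [a, b, c, d, e, f].Nodup := by first | assumption | (simp at * <;> grind only))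
    (h1 : s(a, b) ∈ A := by first | assumption | exact mem_swap (by assumption))
    (h2 : s(b, c) ∈ A := by first | assumption | exact mem_swap (by assumption))
    (h3 : s(c, d) ∈ A := by first | assumption | exact mem_swap (by assumption))
    (h4 : s(d, e) ∈ A := by first | assumption | exact mem_swap (by assumption))
    (h5 : s(e, f) ∈ A := by first | assumption | exact mem_swap (by assumption))
    (h6 : s(f, a) ∈ A := by first | assumption | exact mem_swap (by assumption)) :
    HasShape hexagonEdges A :=
  .of_forall_mem ![a, b, c, d, e, f] (by simpa using hn) (by decide)
    (by simp [hexagonEdges, h1, h2, h3, h4, h5, h6]) hc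

lemma hasShape_diamond (a b c d : V) (hc : A.card = 5)
    (hn : [a, b, c, d].Nodup := by first | assumption | (simp at * <;> grind only))
    (h1 : s(a, b) ∈ A := by first | assumption | exact mem_swap (by assumption))
    (h2 : s(b, c) ∈ A := by first | assumption | exact mem_swap (by assumption))
    (h3 : s(c, d) ∈ A := by first | assumption | exact mem_swap (by assumption))
    (h4 : s(d, a) ∈ A := by first | assumption | exact mem_swap (by assumption))
    (h5 : s(a, c) ∈ A := by first | assumption | exact mem_swap (by assumption)) :
    HasShape diamondEdges A :=
  .of_forall_mem ![a, b, c, d] (by simpa using hn) (by decide)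
    (by simp [diamondEdges, h1, h2, h3, h4, h5]) hc

lemma hasShape_tetra (a b c d : V) (hc : A.card = 6)
    (hn : [a, b, c, d].Nodup := by first | assumption | (simp at * <;> grind only))
    (h1 : s(a, b) ∈ A := by first | assumption | exact mem_swap (by assumption))
    (h2 : s(b, c) ∈ A := by first | assumption | exact mem_swap (by assumption))
    (h3 : s(c, d) ∈ A := by first | assumption | exact mem_swap (by assumption))
    (h4 : s(d, a) ∈ A := by first | assumption | exact mem_swap (by assumption))
    (h5 : s(a, c) ∈ A := by first | assumption | exact mem_swap (by assumption))
    (h6 : s(b, d) ∈ A := by first | assumption | exact mem_swap (by assumption)) :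
    HasShape tetraEdges A :=
  .of_forall_mem ![a, b, c, d] (by simpa using hn) (by decide)
    (by simp [tetraEdges, h1, h2, h3, h4, h5, h6]) hc

lemma hasShape_house (a b c d e : V) (hc : A.card = 6)
    (hn : [a, b, c, d, e].Nodup := by first | assumption | (simp at * <;> grind only))
    (h1 : s(a, b) ∈ A := by first | assumption | exact mem_swap (by assumption))
    (h2 : s(b, c) ∈ A := by first | assumption | exact mem_swap (by assumption))
    (h3 : s(c, d) ∈ A := by first | assumption | exact mem_swap (by assumption))
    (h4 : s(d, e) ∈ A := by first | assumption | exact mem_swap (by assumption))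
    (h5 : s(e, a) ∈ A := by first | assumption | exact mem_swap (by assumption))
    (h6 : s(a, c) ∈ A := by first | assumption | exact mem_swap (by assumption)) :
    HasShape houseEdges A :=
  .of_forall_mem ![a, b, c, d, e] (by simpa using hn) (by decide)
    (by simp [houseEdges, h1, h2, h3, h4, h5, h6]) hc

lemma hasShape_theta (a b c d e : V) (hc : A.card = 6)
    (hn : [a, b, c, d, e].Nodup := by first | assumption | (simp at * <;> grind only))
    (h1 : s(a, d) ∈ A := by first | assumption | exact mem_swap (by assumption))
    (h2 : s(a, e) ∈ A := by first | assumption | exact mem_swap (by assumption))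
    (h3 : s(b, d) ∈ A := by first | assumption | exact mem_swap (by assumption))
    (h4 : s(b, e) ∈ A := by first | assumption | exact mem_swap (by assumption))
    (h5 : s(c, d) ∈ A := by first | assumption | exact mem_swap (by assumption))
    (h6 : s(c, e) ∈ A := by first | assumption | exact mem_swap (by assumption)) :
    HasShape thetaEdges A :=
  .of_forall_mem ![a, b, c, d, e] (by simpa using hn) (by decide)
    (by simp [thetaEdges, h1, h2, h3, h4, h5, h6]) hc

lemma hasShape_bowtie (a b c d e : V) (hc : A.card = 6)
    (hn : [a, b, c, d, e].Nodup := by first | assumption | (simp at * <;> grind only))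
    (h1 : s(a, b) ∈ A := by first | assumption | exact mem_swap (by assumption))
    (h2 : s(b, c) ∈ A := by first | assumption | exact mem_swap (by assumption))
    (h3 : s(c, a) ∈ A := by first | assumption | exact mem_swap (by assumption))
    (h4 : s(c, d) ∈ A := by first | assumption | exact mem_swap (by assumption))
    (h5 : s(d, e) ∈ A := by first | assumption | exact mem_swap (by assumption))
    (h6 : s(e, c) ∈ A := by first | assumption | exact mem_swap (by assumption)) :
    HasShape bowtieEdges A :=
  .of_forall_mem ![a, b, c, d, e] (by simpa using hn) (by decide)
    (by simp [bowtieEdges, h1, h2, h3, h4, h5, h6]) hc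

lemma hasShape_twoTriangle (a b c d e f : V) (hc : A.card = 6)
    (hn : [a, b, c, d, e, f].Nodup := by first | assumption | (simp at * <;> grind only))
    (h1 : s(a, b) ∈ A := by first | assumption | exact mem_swap (by assumption))
    (h2 : s(b, c) ∈ A := by first | assumption | exact mem_swap (by assumption))
    (h3 : s(c, a) ∈ A := by first | assumption | exact mem_swap (by assumption))
    (h4 : s(d, e) ∈ A := by first | assumption | exact mem_swap (by assumption))
    (h5 : s(e, f) ∈ A := by first | assumption | exact mem_swap (by assumption))
    (h6 : s(f, d) ∈ A := by first | assumption | exact mem_swap (by assumption)) :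
    HasShape twoTriangleEdges A :=
  .of_forall_mem ![a, b, c, d, e, f] (by simpa using hn) (by decide)
    (by simp [twoTriangleEdges, h1, h2, h3, h4, h5, h6]) hc

omit [DecidableEq V] in
lemma Leafless.exists_path (hA : Leafless A) (hne : A.Nonempty) : ∃ a b c d, a ≠ b ∧ c ≠ a ∧ c ≠ b ∧
    d ≠ b ∧ d ≠ c ∧ s(a, b) ∈ A ∧ s(b, c) ∈ A ∧ s(c, d) ∈ A := by
  obtain ⟨e, he⟩ := hne
  induction e using Sym2.ind with | _ a b
  obtain ⟨c, hca, hcb, hbc⟩ := hA.exists_next he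
  obtain ⟨d, hdb, hdc, hcd⟩ := hA.exists_next hbc
  exact ⟨a, b, c, d, by rintro rfl; exact hA.loopless _ he, hca, hcb, hdb, hdc, he, hbc, hcd⟩

lemma Leafless.three_le_card (hA : Leafless A) (hne : A.Nonempty) : 3 ≤ A.card := by
  obtain ⟨a, b, c, d, hab, hca, hcb, hdb, hdc, h1, h2, h3⟩ := hA.exists_path hne
  have hL : [s(a, b), s(b, c), s(c, d)].Nodup := by grind [Sym2.eq_iff]
  rw [show 3 = [s(a, b), s(b, c), s(c, d)].length from rfl, ← List.toFinset_card_of_nodup hL]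
  apply Finset.card_le_card
  simp [Finset.insert_subset_iff, h1, h2, h3]

lemma Leafless.hasShape_of_card_eq_three (hA : Leafless A) (hc : A.card = 3) :
    HasShape triangleEdges A := by
  obtain ⟨a, b, c, d, hab, hca, hcb, hdb, hdc, h1, h2, h3⟩ :=
    hA.exists_path (Finset.card_pos.1 (by omega))
  by_cases hda : d = a
  · subst hda
    exact hasShape_triangle d b c hc
  · obtain ⟨x, hxb, hxa, hx⟩ := hA.exists_next (mem_swap h1)
    have := mem_of_card_eq (A := A) (L := [s(a, b), s(b, c), s(c, d)])
      (by grind [Sym2.eq_iff]) (by simp [*]) hc hx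
    grind [Sym2.eq_iff]

lemma Leafless.hasShape_of_card_eq_four (hA : Leafless A) (hc : A.card = 4) :
    HasShape squareEdges A := by
  obtain ⟨a, b, c, d, hab, hca, hcb, hdb, hdc, h1, h2, h3⟩ :=
    hA.exists_path (Finset.card_pos.1 (by omega))
  by_cases hda : d = a
  · subst hda
    obtain ⟨p, q, -, h', hpq, hp, hq⟩ := hA.exists_last (L := [s(d, b), s(b, c), s(c, d)])
      (by grind [Sym2.eq_iff]) (by simp [*]) hc
    simp at hp hq
    grind [Sym2.eq_iff]
  obtain ⟨e, hec, hed, h4⟩ := hA.exists_next h3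
  obtain ⟨x, hxb, hxa, hx⟩ := hA.exists_next (mem_swap h1)
  have := mem_of_card_eq (A := A) (L := [s(a, b), s(b, c), s(c, d), s(d, e)])
      (by grind [Sym2.eq_iff]) (by simp [*]) hc hx
  -- The second edge at a can only be the last edge of the walk, which therefore closes up.
  have hea : e = a := by grind [Sym2.eq_iff]
  subst hea
  exact hasShape_square e b c d hc

/-- Continue a non-backtracking walk until it closes. A triangle is completed by a vertex joined to
two of its corners, a 4-cycle by a chord; otherwise all five edges form a 5-cycle. -/
lemma Leafless.hasShape_of_card_eq_five (hA : Leafless A) (hc : A.card = 5) :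
    HasShape pentagonEdges A ∨ HasShape diamondEdges A := by
  obtain ⟨a, b, c, d, hab, hca, hcb, hdb, hdc, h1, h2, h3⟩ :=
    hA.exists_path (Finset.card_pos.1 (by omega))
  by_cases hda : d = a
  · subst hda
    right
    rcases hA.exists_last_two (L := [s(d, b), s(b, c), s(c, d)])
      (by grind [Sym2.eq_iff]) (by simp [*]) hc with
      ⟨p, q, -, h', hpq, hp, hq⟩ | ⟨p, q, r, h4, h5, hqr, hp, hq, hr⟩
    · simp at hp hq
      grind [Sym2.eq_iff]
    · simp at hp hq hr
      have h : p ≠ b ∧ p ≠ c ∧ p ≠ d := by grind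
      obtain ⟨i1, i2, i3⟩ := h
      have : (q = b ∧ r = c ∨ q = c ∧ r = b) ∨ (q = b ∧ r = d ∨ q = d ∧ r = b) ∨
        (q = c ∧ r = d ∨ q = d ∧ r = c) := by grind
      rcases this with (⟨rfl, rfl⟩ | ⟨rfl, rfl⟩) | (⟨rfl, rfl⟩ | ⟨rfl, rfl⟩) | (⟨rfl, rfl⟩ | ⟨rfl, rfl⟩)
      · exact hasShape_diamond q p r d hc
      · exact hasShape_diamond q p r d hc
      · exact hasShape_diamond q p r c hc
      · exact hasShape_diamond q p r c hc
      · exact hasShape_diamond q p r b hc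
      · exact hasShape_diamond q p r b hc
  obtain ⟨e, hec, hed, h4⟩ := hA.exists_next h3
  by_cases hea : e = a
  · subst hea
    right
    obtain ⟨p, q, h, h', hpq, hp, hq⟩ := hA.exists_last (L := [s(e, b), s(b, c), s(c, d), s(d, e)])
      (by grind [Sym2.eq_iff]) (by simp [*]) hc
    simp at hp hq
    have : s(e, c) ∈ A ∨ s(b, d) ∈ A := by grind [Sym2.eq_iff]
    rcases this with h5 | h5
    · exact hasShape_diamond e b c d hc
    · exact hasShape_diamond b c d e hc
  -- Now bcd is a triangle with the edge ab attached, and the fifth edge must give a its second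
  -- neighbour, c or d.
  by_cases heb : e = b
  · subst heb
    right
    obtain ⟨x, hxb, hxa, hx⟩ := hA.exists_next (mem_swap h1)
    obtain ⟨p, q, h, h', hpq, hp, hq⟩ := hA.exists_last (L := [s(a, e), s(e, c), s(c, d), s(d, e)])
      (by grind [Sym2.eq_iff]) (by simp [*]) hc
    have := mem_of_card_eq (A := A) (L := [s(p, q), s(a, e), s(e, c), s(c, d), s(d, e)])
      (List.nodup_cons.2 ⟨h', by grind [Sym2.eq_iff]⟩) (by simp [*]) hc hx
    have : x = c ∨ x = d := by
      simp at hp hq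
      grind [Sym2.eq_iff]
    rcases this with rfl | rfl
    · exact hasShape_diamond e a x d hc
    · exact hasShape_diamond e a x c hc
  obtain ⟨f, hfd, hfe, h5⟩ := hA.exists_next h4
  obtain ⟨x, hxb, hxa, hx⟩ := hA.exists_next (mem_swap h1)
  have := mem_of_card_eq (A := A) (L := [s(a, b), s(b, c), s(c, d), s(d, e), s(e, f)])
      (by grind [Sym2.eq_iff]) (by simp [*]) hc hx
  have hfa : f = a := by grind [Sym2.eq_iff]
  subst hfa
  left
  exact hasShape_pentagon f b c d e hc

/-- Six leafless edges that contain a 4-cycle with a chord form a `K_4`. -/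
lemma Leafless.hasShape_tetra_of_diamond (hA : Leafless A) (hc : A.card = 6) {a b c d : V}
    (hn : [a, b, c, d].Nodup) (h1 : s(a, b) ∈ A) (h2 : s(b, c) ∈ A) (h3 : s(c, d) ∈ A)
    (h4 : s(d, a) ∈ A) (h5 : s(a, c) ∈ A) : HasShape tetraEdges A := by
  obtain ⟨p, q, h, h', hpq, hp, hq⟩ := hA.exists_last
    (L := [s(a, b), s(b, c), s(c, d), s(d, a), s(a, c)])
      (by simp [Sym2.eq_iff] at * <;> grind only) (by simp [*]) hc
  have hs := mem_swap h
  -- The sixth edge joins two of the four vertices, and bd is the only pair left.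
  have : s(b, d) ∈ A := by simp [Sym2.eq_iff] at * <;> grind only
  exact hasShape_tetra a b c d hc

/-- The edge sets on which `beta` does not vanish, and two more. -/
def SixEdgeShape (A : Finset (Sym2 V)) : Prop :=
  HasShape hexagonEdges A ∨ HasShape tetraEdges A ∨ HasShape houseEdges A ∨
    HasShape thetaEdges A ∨ HasShape bowtieEdges A ∨ HasShape twoTriangleEdges A

/-- The 4-cycle a x b c with chord ab is a diamond, which leaves only K_4. -/
lemma Leafless.sixEdgeShape_of_triangle_of_two (hA : Leafless A) (hc : A.card = 6) {a b c x : V}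
    (hn : [a, b, c, x].Nodup) (h1 : s(a, b) ∈ A) (h2 : s(b, c) ∈ A) (h3 : s(c, a) ∈ A)
    (h4 : s(x, a) ∈ A) (h5 : s(x, b) ∈ A) : SixEdgeShape A :=
  Or.inr (Or.inl (hA.hasShape_tetra_of_diamond hc (a := a) (b := x) (c := b) (d := c)
    (by simp [Sym2.eq_iff] at * <;> grind only) (mem_swap h4) h5 h2 h3 h1))

/-- The sixth edge zw must return to the triangle, or w would have degree one. It returns to y
(bowtie) or to another corner (house). -/
lemma Leafless.sixEdgeShape_of_triangle_of_one (hA : Leafless A) (hc : A.card = 6)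
    {a b y x z : V} (hn : [a, b, y, x, z].Nodup) (h1 : s(a, b) ∈ A) (h2 : s(b, y) ∈ A)
    (h3 : s(y, a) ∈ A) (hxy : s(x, y) ∈ A) (hxz : s(x, z) ∈ A) : SixEdgeShape A := by
  obtain ⟨w, hwx, hwz, hzw⟩ := hA.exists_next hxz
  obtain ⟨w', hw1, hw2, hw3⟩ := hA.exists_next hzw
  have := mem_of_card_eq (A := A)
    (L := [s(a, b), s(b, y), s(y, a), s(x, y), s(x, z), s(z, w)])
      (by simp [Sym2.eq_iff] at * <;> grind only) (by simp [*]) hc hw3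
  have : w = a ∨ w = b ∨ w = y := by simp [Sym2.eq_iff] at * <;> grind only
  rcases this with rfl | rfl | rfl
  · exact Or.inr (Or.inr (Or.inl (hasShape_house w b y x z hc)))
  · exact Or.inr (Or.inr (Or.inl (hasShape_house w a y x z hc)))
  · exact Or.inr (Or.inr (Or.inr (Or.inr (Or.inl (hasShape_bowtie a b w x z hc)))))

/-- One edge remains and both y and z need it, so it is yz. -/
lemma Leafless.sixEdgeShape_of_triangle_of_none (hA : Leafless A) (hc : A.card = 6)
    {a b c x y z : V} (hn : [a, b, c, x, y, z].Nodup) (h1 : s(a, b) ∈ A) (h2 : s(b, c) ∈ A)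
    (h3 : s(c, a) ∈ A) (hxy : s(x, y) ∈ A) (hxz : s(x, z) ∈ A) : SixEdgeShape A := by
  obtain ⟨w, hwx, hwz, hzw⟩ := hA.exists_next hxz
  obtain ⟨w', hw1, hw2, hw3⟩ := hA.exists_next hxy
  by_cases hwy : w = y
  · subst hwy
    exact Or.inr (Or.inr (Or.inr (Or.inr (Or.inr (hasShape_twoTriangle a b c x w z hc)))))
  · have := mem_of_card_eq (A := A)
      (L := [s(a, b), s(b, c), s(c, a), s(x, y), s(x, z), s(z, w)])
        (by simp [Sym2.eq_iff] at * <;> grind only) (by simp [*]) hc hw3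
    simp [Sym2.eq_iff] at * <;> grind only

lemma Leafless.sixEdgeShape_of_triangle_of_edge (hA : Leafless A) (hc : A.card = 6) {a b c x y : V}
    (hn : [a, b, c, x].Nodup) (h1 : s(a, b) ∈ A) (h2 : s(b, c) ∈ A) (h3 : s(c, a) ∈ A)
    (hxy : s(x, y) ∈ A) : SixEdgeShape A := by
  obtain ⟨z, hzy, hzx, hxz⟩ := hA.exists_next (mem_swap hxy)
  have hyx : y ≠ x := by rintro rfl; exact hA.loopless _ hxy
  have cases : ∀ w, w = a ∨ w = b ∨ w = c ∨ w ∉ [a, b, c] := fun w => by simp; tauto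
  have h1' := mem_swap h1
  have h2' := mem_swap h2
  have h3' := mem_swap h3
  rcases cases y with rfl | rfl | rfl | hy <;> rcases cases z with rfl | rfl | rfl | hz
  · exact absurd rfl hzy
  · exact hA.sixEdgeShape_of_triangle_of_two hc hn h1 h2 h3 hxy hxz
  · exact hA.sixEdgeShape_of_triangle_of_two hc
      (by simp [Sym2.eq_iff] at * <;> grind only) h3' h2' h1' hxy hxz
  · exact hA.sixEdgeShape_of_triangle_of_one hc
      (by simp [Sym2.eq_iff] at * <;> grind only) h2 h3 h1 hxy hxz
  · exact hA.sixEdgeShape_of_triangle_of_two hc hn h1 h2 h3 hxz hxy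
  · exact absurd rfl hzy
  · exact hA.sixEdgeShape_of_triangle_of_two hc
      (by simp [Sym2.eq_iff] at * <;> grind only) h2 h3 h1 hxy hxz
  · exact hA.sixEdgeShape_of_triangle_of_one hc
      (by simp [Sym2.eq_iff] at * <;> grind only) h3 h1 h2 hxy hxz
  · exact hA.sixEdgeShape_of_triangle_of_two hc
      (by simp [Sym2.eq_iff] at * <;> grind only) h3' h2' h1' hxz hxy
  · exact hA.sixEdgeShape_of_triangle_of_two hc
      (by simp [Sym2.eq_iff] at * <;> grind only) h2 h3 h1 hxz hxy
  · exact absurd rfl hzy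
  · exact hA.sixEdgeShape_of_triangle_of_one hc
      (by simp [Sym2.eq_iff] at * <;> grind only) h1 h2 h3 hxy hxz
  · exact hA.sixEdgeShape_of_triangle_of_one hc
      (by simp [Sym2.eq_iff] at * <;> grind only) h2 h3 h1 hxz hxy
  · exact hA.sixEdgeShape_of_triangle_of_one hc
      (by simp [Sym2.eq_iff] at * <;> grind only) h3 h1 h2 hxz hxy
  · exact hA.sixEdgeShape_of_triangle_of_one hc
      (by simp [Sym2.eq_iff] at * <;> grind only) h1 h2 h3 hxz hxy
  · exact hA.sixEdgeShape_of_triangle_of_none hc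
      (by simp [Sym2.eq_iff] at * <;> grind only) h1 h2 h3 hxy hxz

lemma Leafless.sixEdgeShape_of_triangle (hA : Leafless A) (hc : A.card = 6) {a b c : V}
    (hn : [a, b, c].Nodup) (h1 : s(a, b) ∈ A) (h2 : s(b, c) ∈ A) (h3 : s(c, a) ∈ A) :
    SixEdgeShape A := by
  obtain ⟨x, y, h, h'⟩ := exists_not_mem_of_length_lt (A := A)
    (L := [s(a, b), s(b, c), s(c, a)]) (by simp [hc])
  have hxy : x ≠ y := by rintro rfl; exact hA.loopless _ h
  by_cases hx : [a, b, c, x].Nodup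
  · exact hA.sixEdgeShape_of_triangle_of_edge hc hx h1 h2 h3 h
  · have hy : [a, b, c, y].Nodup := by simp [Sym2.eq_iff] at * <;> grind only
    exact hA.sixEdgeShape_of_triangle_of_edge hc hy h1 h2 h3 (mem_swap h)

/-- A chord makes a diamond, hence K_4. Otherwise a new vertex is joined to two vertices of the
cycle: adjacent ones give a house, opposite ones a theta. -/
lemma Leafless.sixEdgeShape_of_square (hA : Leafless A) (hc : A.card = 6) {a b c d : V}
    (hn : [a, b, c, d].Nodup) (h1 : s(a, b) ∈ A) (h2 : s(b, c) ∈ A) (h3 : s(c, d) ∈ A)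
    (h4 : s(d, a) ∈ A) : SixEdgeShape A := by
  rcases hA.exists_last_two (L := [s(a, b), s(b, c), s(c, d), s(d, a)])
    (by simp [Sym2.eq_iff] at * <;> grind only) (by simp [*]) hc with
      ⟨p, q, h, h', hpq, hp, hq⟩ | ⟨p, q, r, h5, h6, hqr, hp, hq, hr⟩
  · have hs := mem_swap h
    have : s(a, c) ∈ A ∨ s(b, d) ∈ A := by simp [Sym2.eq_iff] at * <;> grind only
    rcases this with h5 | h5
    · exact Or.inr (Or.inl (hA.hasShape_tetra_of_diamond hc hn h1 h2 h3 h4 h5))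
    · exact Or.inr (Or.inl (hA.hasShape_tetra_of_diamond hc
        (by simp [Sym2.eq_iff] at * <;> grind only) h2 h3 h4 h1 h5))
  · have hp' : [a, b, c, d, p].Nodup := by simp [Sym2.eq_iff] at * <;> grind only
    have hq' : q = a ∨ q = b ∨ q = c ∨ q = d := by simp [Sym2.eq_iff] at * <;> grind only
    have hr' : r = a ∨ r = b ∨ r = c ∨ r = d := by simp [Sym2.eq_iff] at * <;> grind only
    clear hp hq hr
    rcases hq' with rfl | rfl | rfl | rfl <;> rcases hr' with rfl | rfl | rfl | rfl
    · exact absurd rfl hqr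
    · exact Or.inr (Or.inr (Or.inl (hasShape_house q p r c d hc)))
    · exact Or.inr (Or.inr (Or.inr (Or.inl (hasShape_theta p b d q r hc))))
    · exact Or.inr (Or.inr (Or.inl (hasShape_house q p r c b hc)))
    · exact Or.inr (Or.inr (Or.inl (hasShape_house r p q c d hc)))
    · exact absurd rfl hqr
    · exact Or.inr (Or.inr (Or.inl (hasShape_house q p r d a hc)))
    · exact Or.inr (Or.inr (Or.inr (Or.inl (hasShape_theta p a c q r hc))))
    · exact Or.inr (Or.inr (Or.inr (Or.inl (hasShape_theta p b d q r hc))))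
    · exact Or.inr (Or.inr (Or.inl (hasShape_house r p q d a hc)))
    · exact absurd rfl hqr
    · exact Or.inr (Or.inr (Or.inl (hasShape_house q p r a b hc)))
    · exact Or.inr (Or.inr (Or.inl (hasShape_house r p q c b hc)))
    · exact Or.inr (Or.inr (Or.inr (Or.inl (hasShape_theta p a c q r hc))))
    · exact Or.inr (Or.inr (Or.inl (hasShape_house r p q a b hc)))
    · exact absurd rfl hqr

/-- A non-backtracking walk either meets itself within five edges, giving a triangle, a 4-cycle or a
5-cycle (which then has a chord), or its six edges form a 6-cycle. -/
lemma Leafless.sixEdgeShape (hA : Leafless A) (hc : A.card = 6) : SixEdgeShape A := by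
  obtain ⟨a, b, c, d, hab, hca, hcb, hdb, hdc, h1, h2, h3⟩ :=
    hA.exists_path (Finset.card_pos.1 (by omega))
  by_cases hda : d = a
  · subst hda
    exact hA.sixEdgeShape_of_triangle hc (by simp [Sym2.eq_iff] at * <;> grind only) h1 h2 h3
  obtain ⟨e, hec, hed, h4⟩ := hA.exists_next h3
  by_cases hea : e = a
  · subst hea
    exact hA.sixEdgeShape_of_square hc (by simp [Sym2.eq_iff] at * <;> grind only) h1 h2 h3 h4
  by_cases heb : e = b
  · subst heb
    exact hA.sixEdgeShape_of_triangle hc (by simp [Sym2.eq_iff] at * <;> grind only) h2 h3 h4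
  obtain ⟨f, hfd, hfe, h5⟩ := hA.exists_next h4
  by_cases hfb : f = b
  · subst hfb
    exact hA.sixEdgeShape_of_square hc (by simp [Sym2.eq_iff] at * <;> grind only) h2 h3 h4 h5
  by_cases hfc : f = c
  · subst hfc
    exact hA.sixEdgeShape_of_triangle hc (by simp [Sym2.eq_iff] at * <;> grind only) h3 h4 h5
  by_cases hfa : f = a
  · subst hfa
    obtain ⟨p, q, h, h', hpq, hp, hq⟩ := hA.exists_last
      (L := [s(f, b), s(b, c), s(c, d), s(d, e), s(e, f)])
        (by simp [Sym2.eq_iff] at * <;> grind only) (by simp [*]) hc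
    have hs := mem_swap h
    have : s(f, c) ∈ A ∨ s(b, d) ∈ A ∨ s(c, e) ∈ A ∨ s(d, f) ∈ A ∨ s(e, b) ∈ A := by
      simp [Sym2.eq_iff] at * <;> grind (splits := 20) only
    refine Or.inr (Or.inr (Or.inl ?_))
    rcases this with h6 | h6 | h6 | h6 | h6
    · exact hasShape_house f b c d e hc
    · exact hasShape_house b c d e f hc
    · exact hasShape_house c d e f b hc
    · exact hasShape_house d e f b c hc
    · exact hasShape_house e f b c d hc
  obtain ⟨g, hge, hgf, h6⟩ := hA.exists_next h5
  obtain ⟨x, hxb, hxa, hx⟩ := hA.exists_next (mem_swap h1)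
  have := mem_of_card_eq (A := A) (L := [s(a, b), s(b, c), s(c, d), s(d, e), s(e, f), s(f, g)])
      (by simp [Sym2.eq_iff] at * <;> grind only) (by simp [*]) hc hx
  have hga : g = a := by simp [Sym2.eq_iff] at * <;> grind only
  subst hga
  exact Or.inl (hasShape_hexagon g b c d e f hc)

end Classification

/-! ### Beta on edge sets of each size -/

section Values

variable {V : Type*} [DecidableEq V] {A : Finset (Sym2 V)}

omit [DecidableEq V] in
lemma leafless_or_exists_isPendant (hA : ∀ x, s(x, x) ∉ A) :
    Leafless A ∨ ∃ u v, IsPendant A u v := by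
  by_cases h : ∃ u v, IsPendant A u v
  · exact Or.inr h
  · push Not at h
    exact Or.inl ⟨hA, h⟩

variable [Fintype V]

lemma edgeRank_of_card_le_two (hA : ∀ x, s(x, x) ∉ A) (hc : A.card ≤ 2) :
    edgeRank A = A.card := by
  obtain ⟨n, hn⟩ : ∃ n, A.card = n := ⟨_, rfl⟩
  induction n generalizing A with
  | zero => rw [Finset.card_eq_zero.1 hn]; simp
  | succ n ih =>
    rcases leafless_or_exists_isPendant hA with h | ⟨u, v, h⟩
    · have := h.three_le_card (Finset.card_pos.1 (by omega))
      omega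
    · have he := Finset.card_erase_of_mem h.2.1
      rw [h.edgeRank_eq, ih (fun x hx => hA x (Finset.mem_of_mem_erase hx)) (by omega) (by omega)]
      omega

lemma two_le_edgeRank (hA : ∀ x, s(x, x) ∉ A) (hc : A.card = 3) : 2 ≤ edgeRank A := by
  rcases leafless_or_exists_isPendant hA with h | ⟨u, v, h⟩
  · exact (edgeRank_of_triangle (h.hasShape_of_card_eq_three hc)).ge
  · have he := Finset.card_erase_of_mem h.2.1
    rw [h.edgeRank_eq,
      edgeRank_of_card_le_two (fun x hx => hA x (Finset.mem_of_mem_erase hx)) (by omega)]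
    omega

/-- Used to show that five edges with a pendant one have rank at least 4, so that rank 3 singles out
the diamond. -/
lemma three_le_edgeRank (hA : ∀ x, s(x, x) ∉ A) (hc : A.card = 4) : 3 ≤ edgeRank A := by
  rcases leafless_or_exists_isPendant hA with h | ⟨u, v, h⟩
  · exact (edgeRank_of_square (h.hasShape_of_card_eq_four hc)).ge
  · have he := Finset.card_erase_of_mem h.2.1
    have := two_le_edgeRank (A := A.erase s(u, v))
      (fun x hx => hA x (Finset.mem_of_mem_erase hx)) (by omega)
    rw [h.edgeRank_eq]
    omega

open Classical in
lemma beta_of_card_eq_three (hA : ∀ x, s(x, x) ∉ A) (hc : A.card = 3) :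
    beta A = if HasShape triangleEdges A then 1 else 0 := by
  split_ifs with h
  · exact beta_of_triangle h
  · rcases leafless_or_exists_isPendant hA with h' | ⟨u, v, h'⟩
    · exact absurd (h'.hasShape_of_card_eq_three hc) h
    · exact h'.beta_eq_zero (by omega)

open Classical in
lemma beta_of_card_eq_four (hA : ∀ x, s(x, x) ∉ A) (hc : A.card = 4) :
    beta A = if HasShape squareEdges A then 1 else 0 := by
  split_ifs with h
  · exact beta_of_square h
  · rcases leafless_or_exists_isPendant hA with h' | ⟨u, v, h'⟩
    · exact absurd (h'.hasShape_of_card_eq_four hc) h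
    · exact h'.beta_eq_zero (by omega)

open Classical in
lemma beta_of_card_eq_five (hA : ∀ x, s(x, x) ∉ A) (hc : A.card = 5) :
    beta A = (if HasShape pentagonEdges A then 1 else 0) - if edgeRank A = 3 then 1 else 0 := by
  rcases leafless_or_exists_isPendant hA with h | ⟨u, v, h⟩
  · rcases h.hasShape_of_card_eq_five hc with h | h
    · simp [h, beta_of_pentagon h, edgeRank_of_pentagon h]
    · have h' : ¬ HasShape pentagonEdges A := fun h' => by
        have := beta_of_pentagon h'
        rw [beta_of_diamond h] at this
        omega
      simp [h', beta_of_diamond h, edgeRank_of_diamond h]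
  · have hb := h.beta_eq_zero (by omega)
    have h' : ¬ HasShape pentagonEdges A := fun h' => by
      have := beta_of_pentagon h'
      omega
    have he := Finset.card_erase_of_mem h.2.1
    have := three_le_edgeRank (A := A.erase s(u, v))
      (fun x hx => hA x (Finset.mem_of_mem_erase hx)) (by omega)
    have hr : edgeRank A ≠ 3 := by rw [h.edgeRank_eq]; omega
    simp [h', hb, hr]

open Classical in
lemma beta_of_card_eq_six (hA : ∀ x, s(x, x) ∉ A) (hc : A.card = 6) :
    beta A = (if HasShape hexagonEdges A then 1 else 0) +
      2 * (if HasShape tetraEdges A then 1 else 0) - (if HasShape houseEdges A then 1 else 0) -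
      if HasShape thetaEdges A then 1 else 0 := by
  have h1 : HasShape hexagonEdges A → beta A = 1 := beta_of_hexagon
  have h2 : HasShape tetraEdges A → beta A = 2 := beta_of_tetra
  have h3 : HasShape houseEdges A → beta A = -1 := beta_of_house
  have h4 : HasShape thetaEdges A → beta A = -1 := beta_of_theta
  -- Only house and theta share a value of `beta`; all other coincidences are excluded by the values
  -- themselves.
  have h5 : HasShape houseEdges A → ¬ HasShape thetaEdges A := not_theta_of_house
  have h6 : HasShape hexagonEdges A ∨ HasShape tetraEdges A ∨ HasShape houseEdges A ∨
      HasShape thetaEdges A ∨ beta A = 0 := by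
    rcases leafless_or_exists_isPendant hA with h | ⟨u, v, h⟩
    · rcases h.sixEdgeShape hc with h | h | h | h | h | h
      · exact Or.inl h
      · exact Or.inr (Or.inl h)
      · exact Or.inr (Or.inr (Or.inl h))
      · exact Or.inr (Or.inr (Or.inr (Or.inl h)))
      · exact Or.inr (Or.inr (Or.inr (Or.inr (beta_of_bowtie h))))
      · exact Or.inr (Or.inr (Or.inr (Or.inr (beta_of_twoTriangle h))))
    · exact Or.inr (Or.inr (Or.inr (Or.inr (h.beta_eq_zero (by omega)))))
  grind

end Values

/-! ### Subgraph counts as counts of edge sets -/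

section Counts

variable {V : Type*} [DecidableEq V] {W : Type*}

lemma edgesOf_comp {U : Type*} [DecidableEq W] (f : W → V) (g : U → W) (L : List (U × U)) :
    edgesOf (f ∘ g) L = (edgesOf g L).image (Sym2.map f) := by
  induction L with
  | nil => simp
  | cons p L ih => simp [Finset.image_insert, ih]

lemma mem_range_of_mem_edgesOf {f : W → V} {L : List (W × W)} {x y : V}
    (h : s(x, y) ∈ edgesOf f L) : x ∈ Set.range f := by
  simp only [edgesOf, List.mem_toFinset, List.mem_map, Sym2.eq_iff] at h
  obtain ⟨p, -, ⟨rfl, -⟩ | ⟨-, rfl⟩⟩ := h <;> exact ⟨_, rfl⟩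

variable {G : SimpleGraph V}

/-- The subgraph with vertex set the range of `f` and edge set `edgesOf f L`. -/
def shapeSubgraph (G : SimpleGraph V) (f : W → V) (L : List (W × W))
    (h : (edgesOf f L : Set (Sym2 V)) ⊆ G.edgeSet) : G.Subgraph where
  verts := Set.range f
  Adj x y := s(x, y) ∈ edgesOf f L
  adj_sub hxy := h hxy
  edge_vert hxy := mem_range_of_mem_edgesOf hxy
  symm := ⟨fun _ _ hxy => mem_swap hxy⟩

@[simp] lemma edgeSet_shapeSubgraph (f : W → V) (L : List (W × W))
    (h : (edgesOf f L : Set (Sym2 V)) ⊆ G.edgeSet) :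
    (shapeSubgraph G f L h).edgeSet = edgesOf f L := by
  ext e
  induction e using Sym2.ind with | _ x y
  rfl

/-- A graph with edges listed in `L` is isomorphic to its image. -/
lemma nonempty_iso_shapeSubgraph {f : W → V} (hf : Function.Injective f) {L : List (W × W)}
    (h : (edgesOf f L : Set (Sym2 V)) ⊆ G.edgeSet) {H : SimpleGraph W}
    (hL : ∀ x y, H.Adj x y ↔ s(x, y) ∈ L.map fun p => s(p.1, p.2)) :
    Nonempty (H ≃g (shapeSubgraph G f L h).coe) := by
  refine ⟨⟨Equiv.ofInjective f hf, ?_⟩⟩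
  intro x y
  rw [hL, ← mem_edgesOf hf]
  rfl

lemma edgeSet_eq_edgesOf {K : G.Subgraph} {L : List (W × W)} {H : SimpleGraph W}
    (hL : ∀ x y, H.Adj x y ↔ s(x, y) ∈ L.map fun p => s(p.1, p.2)) (φ : H ≃g K.coe) :
    K.edgeSet = edgesOf (fun x => (φ x : V)) L := by
  have hinj : Function.Injective (fun x => (φ x : V)) := Subtype.val_injective.comp φ.injective
  ext e
  induction e using Sym2.ind with | _ x y
  have key : ∀ a b, K.Adj (φ a) (φ b) ↔ s((φ a : V), (φ b : V)) ∈ edgesOf (fun x => (φ x : V)) L := by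
    intro a b
    rw [mem_edgesOf (f := fun x => (φ x : V)) hinj, ← hL, ← φ.map_adj_iff]
    rfl
  rw [SimpleGraph.Subgraph.mem_edgeSet, Finset.mem_coe]
  constructor
  · intro h
    obtain ⟨a, ha⟩ := φ.surjective ⟨x, K.edge_vert h⟩
    obtain ⟨b, hb⟩ := φ.surjective ⟨y, K.edge_vert h.symm⟩
    have := (key a b).1 (by rw [ha, hb]; exact h)
    rwa [ha, hb] at this
  · intro h
    obtain ⟨a, rfl⟩ := mem_range_of_mem_edgesOf h
    obtain ⟨b, rfl⟩ := mem_range_of_mem_edgesOf (mem_swap h)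
    exact (key a b).2 h

open Classical in
/-- Subgraphs without isolated vertices are counted by their edge sets. -/
lemma ncard_eq_card_filter [Fintype V] [Fintype G.edgeSet] {S : Set G.Subgraph}
    {P : Finset (Sym2 V) → Prop} {m : ℕ}
    (hS : ∀ H ∈ S, ∀ x ∈ H.verts, ∃ y, H.Adj x y)
    (h1 : ∀ H ∈ S, ∃ A : Finset (Sym2 V), P A ∧ A.card = m ∧ H.edgeSet = A)
    (h2 : ∀ A : Finset (Sym2 V), P A → (A : Set (Sym2 V)) ⊆ G.edgeSet →
      ∃ H ∈ S, H.edgeSet = A) :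
    S.ncard = ((G.edgeFinset.powersetCard m).filter P).card := by
  have hinj : Set.InjOn (fun H : G.Subgraph => H.edgeSet) S := by
    intro H hH K hK hHK
    have hadj : ∀ x y, H.Adj x y ↔ K.Adj x y := fun x y => by
      rw [← SimpleGraph.Subgraph.mem_edgeSet, ← SimpleGraph.Subgraph.mem_edgeSet]
      exact Set.ext_iff.1 hHK s(x, y)
    refine SimpleGraph.Subgraph.ext ?_ (by ext x y; exact hadj x y)
    ext x
    constructor
    · intro hx
      obtain ⟨y, hy⟩ := hS H hH x hx
      exact K.edge_vert ((hadj x y).1 hy)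
    · intro hx
      obtain ⟨y, hy⟩ := hS K hK x hx
      exact H.edge_vert ((hadj x y).2 hy)
  rw [← Set.ncard_coe_finset, ← Set.ncard_image_of_injOn hinj,
    ← Set.ncard_image_of_injective _ (Finset.coe_injective (α := Sym2 V))]
  congr 1
  ext T
  simp only [Set.mem_image, Finset.coe_filter, Set.mem_setOf_eq, Finset.mem_powersetCard]
  constructor
  · rintro ⟨H, hH, rfl⟩
    obtain ⟨A, hA, hc, hAe⟩ := h1 H hH
    refine ⟨A, ⟨⟨?_, hc⟩, hA⟩, hAe.symm⟩
    rw [← Finset.coe_subset, SimpleGraph.coe_edgeFinset, ← hAe]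
    exact H.edgeSet_subset
  · rintro ⟨A, ⟨⟨hA, hc⟩, hP⟩, rfl⟩
    exact h2 A hP (by rwa [← SimpleGraph.coe_edgeFinset, Finset.coe_subset])

open Classical in
-- By `hdeg` a copy has no isolated vertices, so its edge set determines it. The bijection σ
-- transports the graph to `Fin n`.
lemma copyCount_eq_card_filter [Fintype V] [Fintype G.edgeSet] {H : SimpleGraph W} {n : ℕ}
    {L : List (Fin n × Fin n)} (σ : Fin n ≃ W)
    (hH : ∀ x y, H.Adj (σ x) (σ y) ↔ s(x, y) ∈ L.map fun p => s(p.1, p.2))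
    (hL : (L.map fun p => s(p.1, p.2)).Nodup)
    (hdeg : ∀ x, ∃ y, s(x, y) ∈ L.map fun p => s(p.1, p.2)) :
    G.copyCount H = ((G.edgeFinset.powersetCard L.length).filter (HasShape L)).card := by
  have hadj : ∀ x y, (H.comap σ).Adj x y ↔ s(x, y) ∈ L.map fun p => s(p.1, p.2) := hH
  have : G.copyCount H = Set.ncard {K : G.Subgraph | Nonempty (H ≃g K.coe)} := by
    rw [SimpleGraph.copyCount, ← Set.ncard_coe_finset]
    congr 1
    ext K
    simp
  rw [this]
  apply ncard_eq_card_filter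
  · rintro K ⟨φ⟩ x hx
    obtain ⟨a, ha⟩ := φ.surjective ⟨x, hx⟩
    obtain ⟨a, rfl⟩ := σ.surjective a
    obtain ⟨b, hb⟩ := hdeg a
    rw [← hH, ← φ.map_adj_iff, ha] at hb
    exact ⟨_, hb⟩
  · rintro K ⟨φ⟩
    have hinj : Function.Injective (fun x => (φ (σ x) : V)) :=
      Subtype.val_injective.comp (φ.injective.comp σ.injective)
    have hs : HasShape L (edgesOf (fun x => (φ (σ x) : V)) L) := ⟨_, hinj, rfl⟩
    exact ⟨_, hs, hs.card_eq hL, edgeSet_eq_edgesOf hadj ((SimpleGraph.Iso.comap σ H).trans φ)⟩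
  · rintro A ⟨f, hf, rfl⟩ hA
    obtain ⟨φ⟩ := nonempty_iso_shapeSubgraph hf hA hadj
    exact ⟨shapeSubgraph G f L hA, ⟨(SimpleGraph.Iso.comap σ H).symm.trans φ⟩, by simp⟩

open Classical in
lemma cycleCount_three [Fintype V] [Fintype G.edgeSet] : cycleCount G 3 =
    ((G.edgeFinset.powersetCard 3).filter (HasShape triangleEdges)).card :=
  copyCount_eq_card_filter (Equiv.refl _) (by decide) (by decide) (by decide)

open Classical in
lemma cycleCount_four [Fintype V] [Fintype G.edgeSet] : cycleCount G 4 =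
    ((G.edgeFinset.powersetCard 4).filter (HasShape squareEdges)).card :=
  copyCount_eq_card_filter (Equiv.refl _) (by decide) (by decide) (by decide)

open Classical in
lemma cycleCount_five [Fintype V] [Fintype G.edgeSet] : cycleCount G 5 =
    ((G.edgeFinset.powersetCard 5).filter (HasShape pentagonEdges)).card :=
  copyCount_eq_card_filter (Equiv.refl _) (by decide) (by decide) (by decide)

open Classical in
lemma cycleCount_six [Fintype V] [Fintype G.edgeSet] : cycleCount G 6 =
    ((G.edgeFinset.powersetCard 6).filter (HasShape hexagonEdges)).card :=
  copyCount_eq_card_filter (Equiv.refl _) (by decide) (by decide) (by decide)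

open Classical in
lemma completeCount_four [Fintype V] [Fintype G.edgeSet] : completeCount G 4 =
    ((G.edgeFinset.powersetCard 6).filter (HasShape tetraEdges)).card :=
  copyCount_eq_card_filter (Equiv.refl _) (by decide) (by decide) (by decide)

open Classical in
lemma completeBipartiteCount_three_two [Fintype V] [Fintype G.edgeSet] :
    completeBipartiteCount G 3 2 =
    ((G.edgeFinset.powersetCard 6).filter (HasShape thetaEdges)).card :=
  copyCount_eq_card_filter (finSumFinEquiv (m := 3) (n := 2)).symm
    (by simp only [completeBipartiteGraph_adj]; decide) (by decide) (by decide)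

lemma cycleGraph_five_adj : ∀ x y, (SimpleGraph.cycleGraph 5).Adj x y ↔
    s(x, y) ∈ pentagonEdges.map fun p => s(p.1, p.2) := by decide

/-- Rotating the house fixes its 5-cycle and moves its chord to {k, k + 2}. By `exists_chord` these
are all the chords, so every 5-cycle with a chord is a house. -/
lemma edgesOf_add_houseEdges : ∀ k : Fin 5,
    edgesOf (· + k) houseEdges = insert s(k, k + 2) (edgesOf id pentagonEdges) := by decide

lemma exists_chord : ∀ i j : Fin 5, i ≠ j → s(i, j) ∉ (pentagonEdges.map fun p => s(p.1, p.2)) →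
    ∃ k, s(i, j) = s(k, k + 2) := by decide

lemma edgesOf_houseEdges (f : Fin 5 → V) :
    edgesOf f houseEdges = insert s(f 0, f 2) (edgesOf f pentagonEdges) := by
  have := congrArg (Finset.image (Sym2.map f)) (edgesOf_add_houseEdges 0)
  rw [← edgesOf_comp, Finset.image_insert, ← edgesOf_comp] at this
  simpa [Function.comp_def] using this

open Classical in
lemma chordedCycleCount_five [Fintype V] [Fintype G.edgeSet] : chordedCycleCount G 5 =
    ((G.edgeFinset.powersetCard 6).filter (HasShape houseEdges)).card := by
  apply ncard_eq_card_filter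
  · rintro H ⟨C, hCH, ⟨φ⟩, hv, -⟩ x hx
    obtain ⟨a, ha⟩ := φ.surjective ⟨x, hv ▸ hx⟩
    have hb : (SimpleGraph.cycleGraph 5).Adj a (a + 1) :=
      (by decide : ∀ a, (SimpleGraph.cycleGraph 5).Adj a (a + 1)) a
    rw [← φ.map_adj_iff, ha] at hb
    exact ⟨_, hCH.2 hb⟩
  · rintro H ⟨C, hCH, ⟨φ⟩, hv, hd⟩
    have hC := edgeSet_eq_edgesOf cycleGraph_five_adj φ
    set g : Fin 5 → V := fun x => (φ x : V) with hg
    have hinj : Function.Injective g := Subtype.val_injective.comp φ.injective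
    obtain ⟨e, he⟩ := Set.ncard_eq_one.1 hd
    have hH : H.edgeSet = insert e C.edgeSet := by
      rw [← Set.sdiff_union_of_subset (SimpleGraph.Subgraph.edgeSet_mono hCH), he]
      rfl
    have heH : e ∈ H.edgeSet \ C.edgeSet := by rw [he]; rfl
    induction e using Sym2.ind with | _ x y
    have hadj : H.Adj x y := heH.1
    obtain ⟨i, hi⟩ := φ.surjective ⟨x, hv ▸ H.edge_vert hadj⟩
    obtain ⟨j, hj⟩ := φ.surjective ⟨y, hv ▸ H.edge_vert hadj.symm⟩
    have hi' : g i = x := by rw [hg]; simp [hi]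
    have hj' : g j = y := by rw [hg]; simp [hj]
    have hij : i ≠ j := by
      rintro rfl
      exact hadj.ne (hi'.symm.trans hj')
    have hn := heH.2
    rw [hC, Finset.mem_coe, ← hi', ← hj', mem_edgesOf hinj] at hn
    obtain ⟨k, hk⟩ := exists_chord i j hij hn
    have hshape : HasShape houseEdges (edgesOf (g ∘ (· + k)) houseEdges) :=
      ⟨_, hinj.comp (add_left_injective k), rfl⟩
    refine ⟨_, hshape, hshape.card_eq (by decide), ?_⟩
    rw [edgesOf_comp, edgesOf_add_houseEdges, Finset.image_insert, ← edgesOf_comp, hH, hC, ← hk,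
      ← hi', ← hj']
    simp
  · rintro A ⟨f, hf, rfl⟩ hA
    have hC : (edgesOf f pentagonEdges : Set (Sym2 V)) ⊆ G.edgeSet := by
      refine subset_trans ?_ hA
      rw [Finset.coe_subset, edgesOf_houseEdges]
      exact Finset.subset_insert _ _
    refine ⟨shapeSubgraph G f houseEdges hA, ⟨shapeSubgraph G f pentagonEdges hC, ⟨subset_rfl, ?_⟩,
      nonempty_iso_shapeSubgraph hf hC cycleGraph_five_adj, rfl, ?_⟩, by simp⟩
    · intro x y h
      change s(x, y) ∈ edgesOf f houseEdges
      rw [edgesOf_houseEdges]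
      exact Finset.mem_insert_of_mem h
    · have hn : s(f 0, f 2) ∉ edgesOf f pentagonEdges := by
        rw [mem_edgesOf hf]; decide
      rw [edgeSet_shapeSubgraph, edgeSet_shapeSubgraph, edgesOf_houseEdges, ← Finset.coe_sdiff,
        Set.ncard_coe_finset, Finset.insert_sdiff_of_notMem _ hn]
      simp

end Counts

/-! ### The integrand as an expected rank deficit -/

section Integrand

variable {V : Type*} [Fintype V] [DecidableEq V] (G : SimpleGraph V) [DecidableRel G.Adj]

/-- The expectation of `r(G) - r(A)` for a random edge set `A` containing each edge of `G`
independently with probability `X`. -/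
noncomputable def steelePolynomial : ℝ[X] :=
  ∑ A ∈ G.edgeFinset.powerset, (((rank G : ℤ) - (edgeRank A : ℤ) : ℤ) : ℝ[X]) *
    (Polynomial.X ^ A.card * (1 - Polynomial.X) ^ (G.edgeFinset \ A).card)

/-- The coefficients of `steelePolynomial G`. -/
noncomputable def steeleCoeff (i : ℕ) : ℤ :=
  ∑ A ∈ G.edgeFinset.powersetCard i, mobius (fun B => (rank G : ℤ) - (edgeRank B : ℤ)) A

lemma steelePolynomial_eq_sum : steelePolynomial G =
    ∑ i ∈ Finset.range (G.edgeFinset.card + 1),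
      Polynomial.C (steeleCoeff G i : ℝ) * Polynomial.X ^ i := by
  rw [steelePolynomial,
    sum_mul_pow_eq_sum_mobius Polynomial.X (fun B => (rank G : ℤ) - (edgeRank B : ℤ)),
    Finset.sum_powerset]
  refine Finset.sum_congr rfl fun i _ => ?_
  rw [steeleCoeff, Int.cast_sum, map_sum, Finset.sum_mul]
  refine Finset.sum_congr rfl fun A hA => ?_
  rw [(Finset.mem_powersetCard.1 hA).2]
  simp

lemma loopless_of_subset {V : Type*} {G : SimpleGraph V} [Fintype G.edgeSet] {A : Finset (Sym2 V)}
    (hA : A ⊆ G.edgeFinset) (x : V) : s(x, x) ∉ A := fun h => by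
  have := hA h
  rw [SimpleGraph.mem_edgeFinset] at this
  exact G.loopless.irrefl x this

lemma steeleCoeff_eq_sum_beta {i : ℕ} (hi : 0 < i) :
    steeleCoeff G i = ∑ A ∈ G.edgeFinset.powersetCard i, beta A :=
  Finset.sum_congr rfl fun A hA => mobius_sub_edgeRank _
    (Finset.card_pos.1 (by rw [(Finset.mem_powersetCard.1 hA).2]; exact hi))

lemma steeleCoeff_three : steeleCoeff G 3 = cycleCount G 3 := by
  classical
  rw [steeleCoeff_eq_sum_beta G (by omega), cycleCount_three, Finset.sum_congr rfl fun A hA =>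
    beta_of_card_eq_three (loopless_of_subset (Finset.mem_powersetCard.1 hA).1)
      (Finset.mem_powersetCard.1 hA).2]
  simp

lemma steeleCoeff_four : steeleCoeff G 4 = cycleCount G 4 := by
  classical
  rw [steeleCoeff_eq_sum_beta G (by omega), cycleCount_four, Finset.sum_congr rfl fun A hA =>
    beta_of_card_eq_four (loopless_of_subset (Finset.mem_powersetCard.1 hA).1)
      (Finset.mem_powersetCard.1 hA).2]
  simp

lemma steeleCoeff_five : steeleCoeff G 5 = (cycleCount G 5 : ℤ) - rankCount G 3 5 := by
  classical
  rw [steeleCoeff_eq_sum_beta G (by omega), cycleCount_five, rankCount,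
    Finset.sum_congr rfl fun A hA =>
      beta_of_card_eq_five (loopless_of_subset (Finset.mem_powersetCard.1 hA).1)
        (Finset.mem_powersetCard.1 hA).2]
  simp [Finset.sum_sub_distrib]

lemma steeleCoeff_six : steeleCoeff G 6 = (cycleCount G 6 : ℤ) + 2 * completeCount G 4 -
    chordedCycleCount G 5 - completeBipartiteCount G 3 2 := by
  classical
  rw [steeleCoeff_eq_sum_beta G (by omega), cycleCount_six, completeCount_four,
    chordedCycleCount_five, completeBipartiteCount_three_two,
    Finset.sum_congr rfl fun A hA =>
      beta_of_card_eq_six (loopless_of_subset (Finset.mem_powersetCard.1 hA).1)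
        (Finset.mem_powersetCard.1 hA).2]
  simp only [Finset.sum_sub_distrib, Finset.sum_add_distrib, ← Finset.mul_sum]
  simp

omit [DecidableEq V] in
lemma sub_one_mul_deriv_tutte (x y : ℝ) : (x - 1) * deriv (fun x => tutte G x y) x =
    ∑ A ∈ G.edgeFinset.powerset, ((rank G : ℝ) - edgeRank A) *
      ((x - 1) ^ (rank G - edgeRank A) * (y - 1) ^ (A.card - edgeRank A)) := by
  have h : HasDerivAt (fun x => tutte G x y) (∑ A ∈ G.edgeFinset.powerset,
      ((rank G - edgeRank A : ℕ) : ℝ) * (x - 1) ^ (rank G - edgeRank A - 1) * 1 *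
        (y - 1) ^ (A.card - edgeRank A)) x :=
    HasDerivAt.fun_sum fun A _ => (((hasDerivAt_id x).sub_const 1).pow _).mul_const _
  rw [h.deriv, Finset.mul_sum]
  refine Finset.sum_congr rfl fun A hA => ?_
  have hr : edgeRank A ≤ rank G := by
    rw [← edgeRank_edgeFinset G]
    exact edgeRank_mono (Finset.mem_powerset.1 hA)
  rw [← Nat.cast_sub hr]
  -- For exponent 0 the truncated exponent in the derivative is harmless, as its coefficient is 0.
  rcases Nat.eq_zero_or_pos (rank G - edgeRank A) with h0 | h0
  · simp [h0]
  · have : (x - 1) ^ (rank G - edgeRank A) = (x - 1) ^ (rank G - edgeRank A - 1) * (x - 1) := by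
      rw [← pow_succ]; congr 1; omega
    rw [this]; ring

/-- With s = (1-t)/t the left side is s^(r(G)-r(A)) s^(r(A)-|A|) = s^(r(G)-|A|), free of r(A). -/
lemma one_sub_pow_mul_weight {t : ℝ} (ht : t ∈ Set.Ioo (0 : ℝ) 1) {A : Finset (Sym2 V)}
    (hA : A ⊆ G.edgeFinset) :
    (1 / t - 1) ^ (rank G - edgeRank A) * (1 / (1 - t) - 1) ^ (A.card - edgeRank A) =
      ((1 - t) / t) ^ rank G / (1 - t) ^ G.edgeFinset.card *
        (t ^ A.card * (1 - t) ^ (G.edgeFinset \ A).card) := by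
  have h0 : t ≠ 0 := ht.1.ne'
  have h1 : 1 - t ≠ 0 := (sub_pos.2 ht.2).ne'
  have hx : 1 / t - 1 = (1 - t) / t := by field_simp
  have hy : 1 / (1 - t) - 1 = ((1 - t) / t)⁻¹ := by field_simp; ring
  have hr : edgeRank A ≤ rank G := by
    rw [← edgeRank_edgeFinset G]
    exact edgeRank_mono hA
  have hs : (1 - t) / t ≠ 0 := div_ne_zero h1 h0
  have hc : (1 - t) ^ G.edgeFinset.card = (1 - t) ^ (G.edgeFinset \ A).card * (1 - t) ^ A.card := by
    rw [← pow_add, Finset.card_sdiff_add_card_eq_card hA]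
  have h2 : ((1 - t) / t) ^ (rank G - edgeRank A) * (((1 - t) / t)⁻¹) ^ (A.card - edgeRank A) =
      ((1 - t) / t) ^ rank G * (((1 - t) / t)⁻¹) ^ A.card := by
    rw [pow_sub₀ _ hs hr, pow_sub₀ _ (inv_ne_zero hs) (edgeRank_le_card A), inv_pow, inv_pow,
      inv_inv]
    field_simp
  rw [hx, hy, h2, hc, inv_div, div_pow t]
  field_simp

lemma isSteelePolynomial_steelePolynomial : IsSteelePolynomial G (steelePolynomial G) := by
  intro t ht
  have h0 : t ≠ 0 := ht.1.ne'
  have h1 : 1 - t ≠ 0 := (sub_pos.2 ht.2).ne'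
  set c : ℝ := ((1 - t) / t) ^ rank G / (1 - t) ^ G.edgeFinset.card with hc
  have hc0 : c ≠ 0 := div_ne_zero (pow_ne_zero _ (div_ne_zero h1 h0)) (pow_ne_zero _ h1)
  have hT : tutte G (1 / t) (1 / (1 - t)) = c := by
    rw [tutte, Finset.sum_congr rfl fun A hA =>
      one_sub_pow_mul_weight G ht (Finset.mem_powerset.1 hA), ← Finset.mul_sum, ← hc]
    -- The probabilities of all edge sets add up to (t + (1-t))^m = 1.
    have := Finset.sum_pow_mul_eq_add_pow t (1 - t) G.edgeFinset
    rw [add_sub_cancel, one_pow] at this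
    rw [Finset.sum_congr rfl fun A hA => by
      rw [Finset.card_sdiff_of_subset (Finset.mem_powerset.1 hA)], this, mul_one]
  have hD : (1 - t) / t * deriv (fun x => tutte G x (1 / (1 - t))) (1 / t) =
      c * (steelePolynomial G).eval t := by
    have hx : (1 - t) / t = 1 / t - 1 := by field_simp
    rw [hx, sub_one_mul_deriv_tutte, steelePolynomial, Polynomial.eval_finsetSum, Finset.mul_sum]
    refine Finset.sum_congr rfl fun A hA => ?_
    rw [one_sub_pow_mul_weight G ht (Finset.mem_powerset.1 hA), ← hc]
    simp
    ring
  rw [steeleIntegrand, hT, ← mul_div_assoc, hD, mul_div_cancel_left₀ _ hc0]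

variable {G}

omit [DecidableEq V] in
lemma IsSteelePolynomial.eq {p q : ℝ[X]} (hp : IsSteelePolynomial G p)
    (hq : IsSteelePolynomial G q) : p = q :=
  Polynomial.eq_of_infinite_eval_eq p q <| (Set.Ioo_infinite zero_lt_one).mono fun t ht =>
    (hp t ht).trans (hq t ht).symm

end Integrand

end SteeleMST

/-! ### The coefficients of the integrand -/

theorem mainTheorem3 {V : Type*} [Fintype V] [DecidableEq V]
    (G : SimpleGraph V) [DecidableRel G.Adj] (hG : G.Connected) :
    (∃! p : Polynomial ℝ, SteeleMST.IsSteelePolynomial G p) ∧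
    ∀ p : Polynomial ℝ, SteeleMST.IsSteelePolynomial G p →
      ∃ a : ℕ → ℝ, (∀ i, G.edgeFinset.card < i → a i = 0) ∧
        p = -1 + ∑ i ∈ Finset.range (G.edgeFinset.card + 1),
          Polynomial.C (a i) * Polynomial.X ^ i ∧
        a 3 = SteeleMST.cycleCount G 3 ∧
        a 4 = SteeleMST.cycleCount G 4 ∧
        a 5 = SteeleMST.cycleCount G 5 - SteeleMST.rankCount G 3 5 ∧
        a 6 = SteeleMST.cycleCount G 6 + 2 * SteeleMST.completeCount G 4
          - SteeleMST.chordedCycleCount G 5 - SteeleMST.completeBipartiteCount G 3 2 := by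
  have hS := SteeleMST.isSteelePolynomial_steelePolynomial G
  refine ⟨⟨_, hS, fun q hq => hq.eq hS⟩, fun p hp => ?_⟩
  -- The extra 1 at i = 0 offsets the -1 split off in the statement.
  refine ⟨fun i => SteeleMST.steeleCoeff G i + if i = 0 then 1 else 0, fun i hi => ?_, ?_, ?_, ?_,
    ?_, ?_⟩
  · have h0 : i ≠ 0 := by omega
    simp [SteeleMST.steeleCoeff, Finset.powersetCard_eq_empty.2 hi, h0]
  · rw [hp.eq hS, SteeleMST.steelePolynomial_eq_sum, Finset.sum_range_succ', Finset.sum_range_succ']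
    simp
    ring
  · simp [SteeleMST.steeleCoeff_three]
  · simp [SteeleMST.steeleCoeff_four]
  · simp [SteeleMST.steeleCoeff_five]
  · simp [SteeleMST.steeleCoeff_six]
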